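/- Let $N\ge 2$ and let $k,l,r$ be integers with $0\le l\le k$ and $0\le r\le k$. Let $$D_N(k,l,r)=\mathbb C[e_1,\dots,e_N]/I_N(k,l,r),$$ where the ideal $I_N(k,l,r)$ is generated by $e_1^{l+1}$, $e_N^{r+1}$ and, for $k+1\le i\le N(k+1)$, by the sums $$\sum_{\substack{1\le\alpha_1,\dots,\alpha_{k+1}\le N\\ \alpha_1+\dots+\alpha_{k+1}=i}} e_{\alpha_1}\cdots e_{\alpha_{k+1}}.$$ Bigrade $\mathbb C[e_1,\dots,e_N]$, and hence $D_N(k,l,r)$, by $\deg_q e_i=i$, $\deg_z e_i=1$, and let $$d_N(k,l,r;q,z)=\sum_{i,j\ge 0} q^i z^j\dim (D_N(k,l,r))^{i,j}$$ be the Hilbert polynomial. For integers $m,n\ge 0$ with $m+n\le N$ let $M_{m,n}\in\mathbb Z^N$ be the point $$M_{m,n}=(\underbrace{l,\,k-l,\,l,\,k-l,\dots}_{m},\ \underbrace{0,\dots,0}_{N-m-n},\ \underbrace{\dots,\,r,\,k-r,\,r}_{n}),$$ and put $\varphi_q(x)=\sum_{i=1}^N i\,x_i$, $\varphi_z(x)=\sum_{i=1}^N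 x_i$. Let $d^{m,n}_N(k,l,r;q,z)\in\mathbb Z[[q,z]]$ be the series $$\frac{q^{\varphi_q(M_{m,n})}\,z^{\varphi_z(M_{m,n})}} {\prod\limits_{i=1}^{[m/2]}(1-q^i)\prod\limits_{i=[m/2]+1}^{m}(1-q^{-i}z^{-1})\prod\limits_{i=m+1}^{N-n}(1-q^iz)\prod\limits_{i=1}^{[n/2]}(1-q^{-i})\prod\limits_{i=[n/2]+1}^{n}(1-q^{i-N-1}z^{-1})},$$ where each factor $\frac1{1-q^\alpha z^\beta}$ is expanded as $\sum_{i\ge 0}q^{i\alpha}z^{i\beta}$ if $\alpha,\beta\ge 0$ and as $-\sum_{i<0}q^{i\alpha}z^{i\beta}$ if $\alpha,\beta\le 0$. Set $$d^e_N=\sum_{\substack{m+n<N,\ \text{or}\\ m+n=N,\ m\text{ even}}} d^{m,n}_N,\qquad d^o_N=\sum_{\substack{m+n<N,\ \text{or}\\ m+n=N,\ m\text{ odd}}} d^{m,n}_N,$$ the sums being over $m,n\ge 0$. Then, in $\mathbb Z[[q,z]]$: (i) if $N$ is odd and $l\le r$, then $d_N(k,l,r;q,z)=d^o_N(k,l,r;q,z)$;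 (ii) if $N$ is odd and $l\ge r$, then $d_N(k,l,r;q,z)=d^e_N(k,l,r;q,z)$; (iii) if $N$ is even and $l+r\le k$, then $d_N(k,l,r;q,z)=d^o_N(k,l,r;q,z)$; (iv) if $N$ is even and $l+r\ge k$, then $d_N(k,l,r;q,z)=d^e_N(k,l,r;q,z)$. -/

import Mathlib

open scoped BigOperators

namespace Bosonic

noncomputable section

/-! ### The bigraded algebra `D_N(k,l,r)` and its Hilbert polynomial -/

/-- The generator `e_i` of `ℂ[e_1, …, e_N]`, for `1 ≤ i ≤ N` (and `0` for any other `i`). -/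
def e (N i : ℕ) : MvPolynomial (Fin N) ℂ :=
  if h : 1 ≤ i ∧ i ≤ N then MvPolynomial.X ⟨i - 1, by omega⟩ else 0

open Classical in
/-- The sum of `e_{α_1} ⋯ e_{α_{k+1}}` over all `1 ≤ α_1, …, α_{k+1} ≤ N` with
`α_1 + ⋯ + α_{k+1} = i`: the coefficient of `t^i` in `e(t)^{k+1}`. The number `α_j` is
represented by the element `α j` of `Fin N` with `α_j = α j + 1`. -/
def currentCoeff (N k i : ℕ) : MvPolynomial (Fin N) ℂ :=
  ∑ α : Fin (k + 1) → Fin N with ∑ j, ((α j : ℕ) + 1) = i, ∏ j, e N ((α j : ℕ) + 1)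

/-- The ideal `I_N(k,l,r)`. -/
def idealI (N k l r : ℕ) : Ideal (MvPolynomial (Fin N) ℂ) :=
  Ideal.span ({e N 1 ^ (l + 1), e N N ^ (r + 1)} ∪
    {p | ∃ i : ℕ, k + 1 ≤ i ∧ i ≤ N * (k + 1) ∧ p = currentCoeff N k i})

/-- The algebra `D_N(k,l,r) = ℂ[e_1, …, e_N] / I_N(k,l,r)`. -/
abbrev algD (N k l r : ℕ) : Type := MvPolynomial (Fin N) ℂ ⧸ idealI N k l r

/-- The bihomogeneous polynomials with `deg_q = i` and `deg_z = j`, where `deg_q e_s = s` and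
`deg_z e_s = 1`. -/
def bihomogeneous (N i j : ℕ) : Submodule ℂ (MvPolynomial (Fin N) ℂ) :=
  MvPolynomial.weightedHomogeneousSubmodule ℂ (fun s : Fin N => (s : ℕ) + 1) i ⊓
    MvPolynomial.homogeneousSubmodule (Fin N) ℂ j

/-- The component `(D_N(k,l,r))^{i,j}` of the induced bigrading: the image of the bihomogeneous
polynomials of bidegree `(i,j)` in the quotient. -/
def component (N k l r i j : ℕ) : Submodule ℂ (algD N k l r) :=
  (bihomogeneous N i j).map (Ideal.Quotient.mkₐ ℂ (idealI N k l r)).toLinearMap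

/-- The ring `ℤ[[q,z]]`: the variable `0` is `q` and the variable `1` is `z`. -/
abbrev Series : Type := MvPowerSeries (Fin 2) ℤ

/-- `d_N(k,l,r;q,z) = ∑_{i,j ≥ 0} q^i z^j dim (D_N(k,l,r))^{i,j}`. -/
def hilbertD (N k l r : ℕ) : Series :=
  fun d => (Module.finrank ℂ (component N k l r (d 0) (d 1)) : ℤ)

/-! ### The contributions of the simple vertices -/

/-- The monomial `q^a z^b`. -/
def qz (a b : ℕ) : Series :=
  (MvPowerSeries.X 0 : Series) ^ a * (MvPowerSeries.X 1 : Series) ^ b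

open Classical in
/-- The expansion of `1 / (1 - q^α z^β)` in positive powers of `q` and `z`, for `(α,β) ≠ (0,0)`:
it is `∑_{i ≥ 0} q^{iα} z^{iβ}` if `α, β ≥ 0`, and `-∑_{i < 0} q^{iα} z^{iβ}` if `α, β ≤ 0`.
(As `(α,β) ≠ (0,0)`, a monomial occurs for at most one `i`.) -/
def geomExpansion (α β : ℤ) : Series := fun d =>
  if 0 ≤ α ∧ 0 ≤ β then
    (if ∃ i : ℤ, 0 ≤ i ∧ (d 0 : ℤ) = i * α ∧ (d 1 : ℤ) = i * β then 1 else 0)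
  else if α ≤ 0 ∧ β ≤ 0 then
    (if ∃ i : ℤ, i < 0 ∧ (d 0 : ℤ) = i * α ∧ (d 1 : ℤ) = i * β then -1 else 0)
  else 0

/-- The `j`-th coordinate, `1 ≤ j ≤ N`, of the point
`M_{m,n} = (l, k-l, l, k-l, …, 0, …, 0, …, r, k-r, r)`, which has `m` coordinates in the first
group and `n` in the last, where `m + n ≤ N`, `l ≤ k` and `r ≤ k`. -/
def vertexCoord (N m n k l r j : ℕ) : ℕ :=
  if j ≤ m then (if Odd j then l else k - l)
  else if N - n < j then (if Even (N - j) then r else k - r)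
  else 0

/-- `φ_q(M_{m,n})`, where `φ_q(x) = ∑ i x_i`. -/
def phiQ (N m n k l r : ℕ) : ℕ := ∑ j ∈ Finset.Icc 1 N, j * vertexCoord N m n k l r j

/-- `φ_z(M_{m,n})`, where `φ_z(x) = ∑ x_i`. -/
def phiZ (N m n k l r : ℕ) : ℕ := ∑ j ∈ Finset.Icc 1 N, vertexCoord N m n k l r j

/-- The contribution `d^{m,n}_N(k,l,r;q,z)` of `M_{m,n}`, for `m + n ≤ N`. -/
def contribution (N m n k l r : ℕ) : Series :=
  qz (phiQ N m n k l r) (phiZ N m n k l r)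
    * (∏ i ∈ Finset.Icc 1 (m / 2), geomExpansion (i : ℤ) 0)
    * (∏ i ∈ Finset.Icc (m / 2 + 1) m, geomExpansion (-(i : ℤ)) (-1))
    * (∏ i ∈ Finset.Icc (m + 1) (N - n), geomExpansion (i : ℤ) 1)
    * (∏ i ∈ Finset.Icc 1 (n / 2), geomExpansion (-(i : ℤ)) 0)
    * (∏ i ∈ Finset.Icc (n / 2 + 1) n, geomExpansion ((i : ℤ) - (N : ℤ) - 1) (-1))

/-- `d^e_N(k,l,r;q,z)`: the sum over all `(m,n)` with `m + n < N`, or `m + n = N` and `m` even. -/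
def sumE (N k l r : ℕ) : Series :=
  ∑ p ∈ Finset.range (N + 1) ×ˢ Finset.range (N + 1) with
      p.1 + p.2 < N ∨ (p.1 + p.2 = N ∧ Even p.1),
    contribution N p.1 p.2 k l r

/-- `d^o_N(k,l,r;q,z)`: the sum over all `(m,n)` with `m + n < N`, or `m + n = N` and `m` odd. -/
def sumO (N k l r : ℕ) : Series :=
  ∑ p ∈ Finset.range (N + 1) ×ˢ Finset.range (N + 1) with
      p.1 + p.2 < N ∨ (p.1 + p.2 = N ∧ Odd p.1),
    contribution N p.1 p.2 k l r

end

end Bosonic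

/-! The monomials `e^b` with `b_1 ≤ l`, `b_N ≤ r` and `b_i + b_{i+1} ≤ k` descend to a basis of
`D_N`. Hence `d_N` counts the lattice points of a polytope, and the right-hand side is a sum over
its vertices in the spirit of Brion's theorem.

Basis. Give `e_i` the weight `i ^ 2`. Among monomials of fixed bidegree, one supported on two
neighbours has the least weight (`quadWeight_lt_of_ne`), so the relations rewrite a monomial with
`b_i + b_{i+1} > k` through heavier ones, and the process stops (`monomial_mem_sup_span`). For
independence, the relations are the coefficients of `e(t)^{k+1}`, so under the apolar pairing a
polynomial killed by the `(k+1)`-st power of every derivation `e_i ↦ t^i`, with suitable bounds on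
its first and last exponents, is orthogonal to the ideal. Products of `k` determinants in the `e_i`
have this property, and they realise every admissible `b` as a leading exponent (`exists_dual`).

Vertex sums. In the fraction field of `ℤ[[q,z]]`, the lattice point sum satisfies a recursion in `l`
that removes the first coordinate and replaces `l` by `k - l`. The vertex sums satisfy it too, with
the two parities exchanged (`vertexSum_succ_sub`), and the odd sum has the correct value at `l = 0`
(`vertexSum_zero`). The odd sum is therefore correct from `l = 0` up to the wall `l = r` (`N` odd)
or `l + r = k` (`N` even). On the wall both sums agree (`wallIdentity`), and beyond it the same
recursion carries the even sum. -/

namespace Bosonic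

/-! ### Derivations and determinants -/

section Derivations

variable {R A : Type*} [CommRing R] [CommRing A] [Algebra R A]

/-- The binomial Leibniz rule stops after two terms because `D (D g) = 0`. -/
theorem derivation_iterate_mul (D : Derivation R A A) {g : A} (hg : D (D g) = 0) (h : A) (n : ℕ) :
    D^[n + 1] (g * h) = g * D^[n + 1] h + (n + 1 : A) * (D g * D^[n] h) := by
  induction n with
  | zero => simp [mul_comm]
  | succ n ih =>
    rw [Function.iterate_succ_apply', ih]
    simp only [map_add, Derivation.leibniz, smul_eq_mul, hg, ← Function.iterate_succ_apply' D]
    simp only [Derivation.map_natCast, Derivation.map_one_eq_zero]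
    push_cast
    ring

/-- Each factor absorbs at most one derivative, so one more derivative than there are factors kills
the product. -/
theorem derivation_iterate_prod_eq_zero (D : Derivation R A A) {κ : Type*} (g : κ → A)
    (hg : ∀ a, D (D (g a)) = 0) (s : Finset κ) : D^[s.card + 1] (∏ a ∈ s, g a) = 0 := by
  classical
  induction s using Finset.induction_on with
  | empty => simp
  | insert a s ha ih =>
    rw [Finset.prod_insert ha, Finset.card_insert_of_notMem ha, derivation_iterate_mul D (hg a),
      Function.iterate_succ_apply', ih]
    simp

theorem derivation_prod {κ : Type*} [DecidableEq κ] (D : Derivation R A A) (f : κ → A)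
    (s : Finset κ) :
    D (∏ i ∈ s, f i) = ∑ i ∈ s, ∏ j ∈ s, Function.update f i (D (f i)) j := by
  induction s using Finset.induction_on with
  | empty => simp
  | insert a s ha ih =>
    rw [Finset.prod_insert ha, Derivation.leibniz, ih, Finset.sum_insert ha, Finset.prod_insert ha,
      Function.update_self, Finset.prod_congr rfl fun j hj =>
        Function.update_of_ne (ne_of_mem_of_not_mem hj ha) _ _, add_comm, smul_eq_mul, smul_eq_mul,
      mul_comm, Finset.mul_sum]
    congr 1
    refine Finset.sum_congr rfl fun i hi => ?_
    rw [Finset.prod_insert ha, Function.update_of_ne (ne_of_mem_of_not_mem hi ha).symm]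

theorem derivation_det {ι : Type*} [Fintype ι] [DecidableEq ι] (D : Derivation R A A)
    (M : Matrix ι ι A) :
    D M.det = ∑ j, (M.updateCol j fun i => D (M i j)).det := by
  simp only [Matrix.det_apply', map_sum, Derivation.leibniz, smul_eq_mul, derivation_prod,
    Derivation.map_intCast, mul_zero, add_zero]
  rw [Finset.sum_comm]
  refine Finset.sum_congr rfl fun σ _ => ?_
  rw [Finset.mul_sum]
  refine Finset.sum_congr rfl fun j _ => congrArg _ (Finset.prod_congr rfl fun i _ => ?_)
  by_cases h : i = j
  · subst h; simp
  · simp [h]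

/-- The derivative of `M` is the rank-one matrix `v wᵀ` with constant entries. Differentiating two
different columns makes both proportional to `v`; differentiating one column twice makes it zero. -/
theorem derivation_derivation_det_eq_zero {ι : Type*} [Fintype ι] [DecidableEq ι]
    (D : Derivation R A A) (M : Matrix ι ι A) (v w : ι → A) (hM : ∀ i j, D (M i j) = v i * w j)
    (hv : ∀ i, D (v i) = 0) (hw : ∀ i, D (w i) = 0) : D (D M.det) = 0 := by
  have key : ∀ j, (M.updateCol j fun i => D (M i j)).det = w j * (M.updateCol j v).det := by
    intro j
    rw [← Matrix.det_updateCol_smul]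
    congr 2
    ext i
    simp [hM, mul_comm]
  rw [derivation_det]
  simp only [key, map_sum, Derivation.leibniz, smul_eq_mul, hw, mul_zero, add_zero]
  refine Finset.sum_eq_zero fun j _ => ?_
  rw [derivation_det, Finset.sum_eq_zero, mul_zero]
  intro j' _
  by_cases h : j' = j
  · subst h
    refine Matrix.det_eq_zero_of_column_eq_zero j' fun i => ?_
    simp [hv]
  · have : (fun i => D ((M.updateCol j v) i j')) = w j' • v := by
      ext i
      simp [h, hM, mul_comm]
    rw [this, Matrix.det_updateCol_smul,
      Matrix.det_zero_of_column_eq (i := j') (j := j) h, mul_zero]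
    intro i
    simp [Ne.symm h]

end Derivations

/-! ### The apolar pairing -/

section Apolar

open MvPolynomial

/-- The derivation along the vector `c`. -/
noncomputable def directional {σ : Type*} (c : σ → ℂ) :
    Derivation ℂ (MvPolynomial σ ℂ) (MvPolynomial σ ℂ) :=
  mkDerivation ℂ fun i => C (c i)

theorem directional_X {σ : Type*} (c : σ → ℂ) (i : σ) : directional c (X i) = C (c i) :=
  mkDerivation_X _ _ _

variable {σ : Type*} [Fintype σ]

/-- The pairing in which multiplication by a variable is adjoint to differentiation. -/
noncomputable def apolar : MvPolynomial σ ℂ →ₗ[ℂ] MvPolynomial σ ℂ →ₗ[ℂ] ℂ :=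
  (basisMonomials σ ℂ).constr ℂ fun b =>
    ((∏ i, (b i).factorial : ℕ) : ℂ) • (MvPolynomial.lcoeff ℂ b : MvPolynomial σ ℂ →ₗ[ℂ] ℂ)

theorem apolar_monomial (b : σ →₀ ℕ) (G : MvPolynomial σ ℂ) :
    apolar (monomial b 1) G = ((∏ i, (b i).factorial : ℕ) : ℂ) * coeff b G := by
  have := (basisMonomials σ ℂ).constr_basis ℂ (fun b =>
    ((∏ i, (b i).factorial : ℕ) : ℂ) • (MvPolynomial.lcoeff ℂ b : MvPolynomial σ ℂ →ₗ[ℂ] ℂ)) b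
  rw [coe_basisMonomials] at this
  rw [apolar, this]
  simp

/-- The factorials in `apolar` are there for this adjunction: `(b_i + 1)!` supplies the factor `b_i
+ 1` of the derivative. -/
theorem apolar_X_mul (i : σ) (f G : MvPolynomial σ ℂ) :
    apolar (X i * f) G = apolar f (pderiv i G) := by
  classical
  suffices h : (apolar (σ := σ)).flip G ∘ₗ LinearMap.mulLeft ℂ (X i) =
      (apolar (σ := σ)).flip (pderiv i G) from LinearMap.congr_fun h f
  refine (basisMonomials σ ℂ).ext fun b => ?_
  simp only [LinearMap.coe_comp, Function.comp_apply, LinearMap.flip_apply,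
    LinearMap.mulLeft_apply, coe_basisMonomials]
  rw [X, monomial_mul, one_mul, apolar_monomial, apolar_monomial, coeff_pderiv, add_comm]
  have : ∏ j, ((b + Finsupp.single i 1 : σ →₀ ℕ) j).factorial = (b i + 1) * ∏ j, (b j).factorial := by
    rw [← Finset.mul_prod_erase _ _ (Finset.mem_univ i),
      ← Finset.mul_prod_erase _ (fun j => (b j).factorial) (Finset.mem_univ i), ← mul_assoc]
    congr 1
    · simp [Nat.factorial_succ]
    · refine Finset.prod_congr rfl fun j hj => ?_
      simp [Finset.ne_of_mem_erase hj]
  rw [this]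
  push_cast
  ring

theorem directional_eq_sum (c : σ → ℂ) (G : MvPolynomial σ ℂ) :
    directional c G = ∑ i, c i • pderiv i G := by
  classical
  have happ (G : MvPolynomial σ ℂ) :
      (∑ i, c i • pderiv i : Derivation ℂ (MvPolynomial σ ℂ) (MvPolynomial σ ℂ)) G =
        ∑ i, c i • pderiv i G := by
    have := congrFun (map_sum (Derivation.coeFnAddMonoidHom (R := ℂ) (A := MvPolynomial σ ℂ)
      (M := MvPolynomial σ ℂ)) (fun i => c i • pderiv i) Finset.univ) G
    exact this.trans (by rw [Finset.sum_apply]; rfl)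
  rw [← happ]
  congr 1
  refine derivation_ext fun j => ?_
  rw [directional_X, happ, Finset.sum_eq_single j (fun i _ h => ?_) (by simp)]
  · simp [smul_eq_C_mul]
  · simp [pderiv_X_of_ne h.symm]

theorem apolar_linear_pow_mul (c : σ → ℂ) (n : ℕ) (f G : MvPolynomial σ ℂ) :
    apolar ((∑ i, C (c i) * X i) ^ n * f) G = apolar f ((directional c)^[n] G) := by
  have step (f G : MvPolynomial σ ℂ) :
      apolar ((∑ i, C (c i) * X i) * f) G = apolar f (directional c G) := by
    rw [Finset.sum_mul, directional_eq_sum, map_sum, map_sum, LinearMap.sum_apply]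
    refine Finset.sum_congr rfl fun i _ => ?_
    rw [mul_assoc, C_mul', map_smul, LinearMap.smul_apply, apolar_X_mul, map_smul]
  induction n generalizing f G with
  | zero => simp
  | succ n ih =>
    rw [Function.iterate_succ_apply, ← ih, ← step, pow_succ', mul_assoc]

theorem apolar_X_pow_mul_eq_zero (i : σ) (n : ℕ) (f G : MvPolynomial σ ℂ)
    (hG : ∀ b ∈ G.support, b i < n) : apolar (X i ^ n * f) G = 0 := by
  suffices h : (apolar (σ := σ)).flip G ∘ₗ LinearMap.mulLeft ℂ (X i ^ n) = 0 from
    LinearMap.congr_fun h f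
  refine (basisMonomials σ ℂ).ext fun b => ?_
  simp only [LinearMap.coe_comp, Function.comp_apply, LinearMap.flip_apply,
    LinearMap.mulLeft_apply, coe_basisMonomials, LinearMap.zero_apply]
  rw [X_pow_eq_monomial, monomial_mul, one_mul, apolar_monomial, mul_eq_zero]
  right
  by_contra h
  have := hG _ (mem_support_iff.mpr h)
  simp at this

end Apolar

open MvPolynomial

/-! ### The generators of the ideal -/

theorem e_succ {N : ℕ} (i : Fin N) : e N ((i : ℕ) + 1) = X i := by
  unfold e
  rw [dif_pos ⟨by omega, i.isLt⟩]
  rfl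

theorem directional_e {N : ℕ} (t : ℂ) {j : ℕ} (h1 : 1 ≤ j) (h2 : j ≤ N) :
    directional (fun i : Fin N => t ^ ((i : ℕ) + 1)) (e N j) = C (t ^ j) := by
  obtain ⟨j, rfl⟩ : ∃ i, j = i + 1 := ⟨j - 1, by omega⟩
  rw [show j + 1 = ((⟨j, h2⟩ : Fin N) : ℕ) + 1 from rfl, e_succ, directional_X]

/-- The relations of the ideal are packed into powers of one linear form `e(t)`, whose adjoint is a
directional derivative. Orthogonality to all of them thus becomes a differential condition for every
`t`. -/
theorem linear_pow_eq_sum (N k : ℕ) (t : ℂ) :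
    (∑ i : Fin N, C (t ^ ((i : ℕ) + 1)) * X i : MvPolynomial (Fin N) ℂ) ^ (k + 1) =
      ∑ i ∈ Finset.range (N * (k + 1) + 1), C (t ^ i) * currentCoeff N k i := by
  classical
  rw [← Fin.prod_const, Finset.prod_univ_sum]
  simp only [currentCoeff, Fintype.piFinset_univ]
  have hmem (α : Fin (k + 1) → Fin N) :
      ∑ j, ((α j : ℕ) + 1) ∈ Finset.range (N * (k + 1) + 1) := by
    rw [Finset.mem_range, Nat.lt_succ_iff]
    calc ∑ j, ((α j : ℕ) + 1) ≤ ∑ _j : Fin (k + 1), N := Finset.sum_le_sum fun j _ => (α j).isLt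
      _ = _ := by simp [mul_comm]
  rw [← Finset.sum_fiberwise_of_maps_to (s := Finset.univ) fun α _ => hmem α]
  refine Finset.sum_congr rfl fun i _ => ?_
  rw [Finset.mul_sum]
  refine Finset.sum_congr (by congr) fun α hα => ?_
  rw [Finset.prod_mul_distrib, ← map_prod, Finset.prod_pow_eq_pow_sum,
    (Finset.mem_filter.mp hα).2]
  simp only [e_succ]

theorem eq_zero_of_forall_sum_pow_mul {M : ℕ} (a : ℕ → ℂ)
    (h : ∀ t : ℂ, ∑ i ∈ Finset.range M, t ^ i * a i = 0) {i : ℕ} (hi : i < M) : a i = 0 := by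
  have : (∑ i ∈ Finset.range M, Polynomial.C (a i) * Polynomial.X ^ i) = 0 := by
    refine Polynomial.funext fun t => ?_
    rw [Polynomial.eval_finsetSum, Polynomial.eval_zero, ← h t]
    refine Finset.sum_congr rfl fun i _ => ?_
    rw [Polynomial.eval_mul, Polynomial.eval_C, Polynomial.eval_pow, Polynomial.eval_X, mul_comm]
  have h2 := congrArg (fun p => Polynomial.coeff p i) this
  simpa [Polynomial.finsetSum_coeff, Polynomial.coeff_C_mul, Polynomial.coeff_X_pow, hi] using h2

theorem apolar_mul_currentCoeff_eq_zero {N k : ℕ} (G f : MvPolynomial (Fin N) ℂ)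
    (hG : ∀ t : ℂ, (directional fun i : Fin N => t ^ ((i : ℕ) + 1))^[k + 1] G = 0) {i : ℕ}
    (hi : i ≤ N * (k + 1)) : apolar (f * currentCoeff N k i) G = 0 := by
  refine eq_zero_of_forall_sum_pow_mul (M := N * (k + 1) + 1)
    (fun i => apolar (f * currentCoeff N k i) G) (fun t => ?_) (Nat.lt_succ_of_le hi)
  have h := apolar_linear_pow_mul (fun i : Fin N => t ^ ((i : ℕ) + 1)) (k + 1) f G
  rw [hG, map_zero, linear_pow_eq_sum, Finset.sum_mul, map_sum, LinearMap.sum_apply] at h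
  rw [← h]
  refine Finset.sum_congr rfl fun j _ => ?_
  rw [mul_assoc, C_mul', map_smul, LinearMap.smul_apply, smul_eq_mul, mul_comm f]

theorem apolar_eq_zero_of_mem_ideal {N k l r : ℕ} (hN : 1 ≤ N) (G : MvPolynomial (Fin N) ℂ)
    (hG : ∀ t : ℂ, (directional fun i : Fin N => t ^ ((i : ℕ) + 1))^[k + 1] G = 0)
    (hl : ∀ b ∈ G.support, b ⟨0, hN⟩ ≤ l) (hr : ∀ b ∈ G.support, b ⟨N - 1, by omega⟩ ≤ r)
    {p : MvPolynomial (Fin N) ℂ} (hp : p ∈ idealI N k l r) : apolar p G = 0 := by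
  -- Allowing all multiples `f * p` makes the claim stable under multiplication by ring elements, as
  -- induction over the span of the generators needs.
  suffices h : ∀ f, apolar (f * p) G = 0 by simpa using h 1
  refine Submodule.span_induction (p := fun p _ => ∀ f, apolar (f * p) G = 0)
    (fun p hp f => ?_) (by simp) (fun x y _ _ hx hy f => ?_) (fun a x _ hx f => ?_) hp
  · have h1 : e N 1 = X ⟨0, hN⟩ := e_succ (⟨0, hN⟩ : Fin N)
    have h2 : e N N = X ⟨N - 1, by omega⟩ := by
      rw [← e_succ]
      congr 1
      simp only
      omega
    rcases hp with hp | ⟨i, -, hi, rfl⟩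
    · rcases hp with rfl | rfl
      · rw [h1, mul_comm]
        exact apolar_X_pow_mul_eq_zero _ _ _ _ fun b hb => Nat.lt_succ_of_le (hl b hb)
      · rw [h2, mul_comm]
        exact apolar_X_pow_mul_eq_zero _ _ _ _ fun b hb => Nat.lt_succ_of_le (hr b hb)
    · exact apolar_mul_currentCoeff_eq_zero G f hG hi
  · rw [mul_add, map_add, LinearMap.add_apply, hx, hy, add_zero]
  · rw [smul_eq_mul, ← mul_assoc]
    exact hx _

/-! ### Leading monomials for the weights `i ^ 2` -/

/-- The weight of a monomial in which `e_i` has weight `i ^ 2`. -/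
def quadWeight {N : ℕ} (b : Fin N →₀ ℕ) : ℕ := ∑ i, b i * ((i : ℕ) + 1) ^ 2

theorem quadWeight_add {N : ℕ} (b c : Fin N →₀ ℕ) :
    quadWeight (b + c) = quadWeight b + quadWeight c := by
  simp [quadWeight, add_mul, Finset.sum_add_distrib]

theorem quadWeight_sum_single {N : ℕ} {ι : Type*} (s : Finset ι) (f : ι → Fin N) :
    quadWeight (∑ t ∈ s, Finsupp.single (f t) 1) = ∑ t ∈ s, ((f t : ℕ) + 1) ^ 2 := by
  classical
  induction s using Finset.induction_on with
  | empty => simp [quadWeight]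
  | insert a s ha ih =>
    rw [Finset.sum_insert ha, Finset.sum_insert ha, quadWeight_add, ih]
    congr 1
    rw [quadWeight, Finset.sum_eq_single (f a) (fun i _ h => by simp [h.symm]) (by simp)]
    simp

/-- The polynomial `P` is `e^b` up to terms of smaller weight, in which moreover the first and last
variables do not occur to a higher power than in `e^b`. -/
def HasLead {N : ℕ} (P : MvPolynomial (Fin N) ℂ) (b : Fin N →₀ ℕ) : Prop :=
  ∃ R, P = monomial b 1 + R ∧ ∀ c ∈ R.support, quadWeight c < quadWeight b ∧
    ∀ i : Fin N, (i : ℕ) = 0 ∨ (i : ℕ) + 1 = N → c i ≤ b i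

theorem HasLead.mul {N : ℕ} {P P' : MvPolynomial (Fin N) ℂ} {b b' : Fin N →₀ ℕ}
    (h : HasLead P b) (h' : HasLead P' b') : HasLead (P * P') (b + b') := by
  classical
  obtain ⟨R, rfl, hR⟩ := h
  obtain ⟨R', rfl, hR'⟩ := h'
  refine ⟨monomial b 1 * R' + R * monomial b' 1 + R * R', ?_, fun c hc => ?_⟩
  · rw [show monomial (b + b') (1 : ℂ) = monomial b 1 * monomial b' 1 by
      rw [monomial_mul, one_mul]]
    ring
  have hmono {b x : Fin N →₀ ℕ} (hx : x ∈ (monomial b (1 : ℂ)).support) : x = b := by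
    simpa using support_monomial_subset hx
  rcases Finset.mem_union.mp (support_add hc) with hc | hc
  · rcases Finset.mem_union.mp (support_add hc) with hc | hc
    · obtain ⟨x, hx, y, hy, rfl⟩ := Finset.mem_add.mp (support_mul _ _ hc)
      obtain rfl := hmono hx
      refine ⟨?_, fun i hi => ?_⟩
      · rw [quadWeight_add, quadWeight_add]
        exact Nat.add_lt_add_left (hR' y hy).1 _
      · exact Nat.add_le_add_left ((hR' y hy).2 i hi) _
    · obtain ⟨x, hx, y, hy, rfl⟩ := Finset.mem_add.mp (support_mul _ _ hc)
      obtain rfl := hmono hy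
      refine ⟨?_, fun i hi => ?_⟩
      · rw [quadWeight_add, quadWeight_add]
        exact Nat.add_lt_add_right (hR x hx).1 _
      · exact Nat.add_le_add_right ((hR x hx).2 i hi) _
  · obtain ⟨x, hx, y, hy, rfl⟩ := Finset.mem_add.mp (support_mul _ _ hc)
    refine ⟨?_, fun i hi => ?_⟩
    · rw [quadWeight_add, quadWeight_add]
      exact Nat.add_lt_add (hR x hx).1 (hR' y hy).1
    · exact Nat.add_le_add ((hR x hx).2 i hi) ((hR' y hy).2 i hi)

theorem HasLead.prod {N : ℕ} {ι : Type*} (s : Finset ι) (P : ι → MvPolynomial (Fin N) ℂ)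
    (b : ι → Fin N →₀ ℕ) (h : ∀ a ∈ s, HasLead (P a) (b a)) :
    HasLead (∏ a ∈ s, P a) (∑ a ∈ s, b a) := by
  classical
  induction s using Finset.induction_on with
  | empty => exact ⟨0, by simp, by simp⟩
  | insert a s ha ih =>
    rw [Finset.prod_insert ha, Finset.sum_insert ha]
    exact (h a (by simp)).mul (ih fun a ha => h a (by simp [ha]))

theorem HasLead.coeff_self {N : ℕ} {P : MvPolynomial (Fin N) ℂ} {b : Fin N →₀ ℕ}
    (h : HasLead P b) : coeff b P = 1 := by
  classical
  obtain ⟨R, rfl, hR⟩ := h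
  rw [coeff_add, coeff_monomial, if_pos rfl, notMem_support_iff.mp fun hb => (hR b hb).1.false,
    add_zero]

theorem HasLead.mem_support {N : ℕ} {P : MvPolynomial (Fin N) ℂ} {b c : Fin N →₀ ℕ}
    (h : HasLead P b) (hc : c ∈ P.support) : (c = b ∨ quadWeight c < quadWeight b) ∧
      ∀ i : Fin N, (i : ℕ) = 0 ∨ (i : ℕ) + 1 = N → c i ≤ b i := by
  classical
  obtain ⟨R, rfl, hR⟩ := h
  rcases Finset.mem_union.mp (support_add hc) with hc | hc
  · have : c = b := by simpa using support_monomial_subset hc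
    subst this
    exact ⟨Or.inl rfl, fun i _ => le_rfl⟩
  · exact ⟨Or.inr (hR c hc).1, (hR c hc).2⟩

/-- Once the squares are expanded, only the cross term `∑ τ(t) w(t)` depends on `τ`. The
rearrangement inequality makes it largest at the identity, strictly because `w` is strictly
increasing. -/
theorem sum_perm_add_sq_lt {m : ℕ} (w : Fin m → ℕ) (hw : StrictMono w) (τ : Equiv.Perm (Fin m))
    (hτ : τ ≠ 1) : ∑ t : Fin m, ((τ t : ℕ) + w t) ^ 2 < ∑ t : Fin m, ((t : ℕ) + w t) ^ 2 := by
  have h1 : ∑ t : Fin m, ((τ t : ℕ)) * w t < ∑ t : Fin m, (t : ℕ) * w t := by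
    refine (Monovary.sum_comp_perm_mul_lt_sum_mul_iff (f := fun t : Fin m => (t : ℕ)) (g := w)
      (fun i j h => (hw.lt_iff_lt.mp h).le)).mpr fun hmono => hτ ?_
    have hs : StrictMono τ := by
      intro i j hij
      exact lt_of_le_of_ne (hmono (hw hij)) fun h => hij.ne (τ.injective h)
    have := (hs.range_inj strictMono_id).mp (by simp)
    exact Equiv.ext fun i => congrFun this i
  have h2 : ∑ t, ((τ t : ℕ)) ^ 2 = ∑ t : Fin m, (t : ℕ) ^ 2 :=
    Equiv.sum_comp τ fun t : Fin m => (t : ℕ) ^ 2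
  simp only [add_sq, Finset.sum_add_distrib, h2, mul_assoc, ← Finset.mul_sum]
  omega

/-- The matrix with entries `e_{s + w_t}`. -/
noncomputable def shiftMatrix (N : ℕ) {m : ℕ} (w : Fin m → ℕ) :
    Matrix (Fin m) (Fin m) (MvPolynomial (Fin N) ℂ) :=
  fun s t => e N (s + w t)

/-- The derivative of `e_{s+w_t}` factors as a power depending on the row times one depending on the
column, a rank-one matrix. The bounds on `s + w_t` exclude entries that are `0` by the default value
of `e`. -/
theorem directional_directional_det_shiftMatrix {N m : ℕ} (w : Fin m → ℕ) (h1 : ∀ t, 1 ≤ w t)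
    (hN : ∀ s t : Fin m, (s : ℕ) + w t ≤ N) (t : ℂ) :
    let D := directional fun i : Fin N => t ^ ((i : ℕ) + 1)
    D (D (shiftMatrix N w).det) = 0 := by
  intro D
  refine derivation_derivation_det_eq_zero D _ (fun s => C (t ^ (s : ℕ))) (fun j => C (t ^ w j))
    (fun i j => ?_) (fun i => derivation_C _ _) fun j => derivation_C _ _
  rw [← C_mul, ← pow_add]
  exact directional_e t (le_add_left (h1 j)) (hN i j)

/-- The diagonal term of the Leibniz expansion is the heaviest by `sum_perm_add_sq_lt`. -/
theorem hasLead_det_shiftMatrix {N m : ℕ} (w : Fin m → ℕ) (hw : StrictMono w)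
    (h1 : ∀ t, 1 ≤ w t) (hN : ∀ s t : Fin m, (s : ℕ) + w t ≤ N) :
    HasLead (shiftMatrix N w).det
      (∑ t, Finsupp.single ⟨t + w t - 1, by have := h1 t; have := hN t t; omega⟩ 1) := by
  classical
  let idx (τ : Equiv.Perm (Fin m)) (t : Fin m) : Fin N :=
    ⟨τ t + w t - 1, by have := h1 t; have := hN (τ t) t; omega⟩
  have hidx (τ t) : (idx τ t : ℕ) + 1 = τ t + w t := by
    have := h1 t
    simp only [idx]
    omega
  let b (τ : Equiv.Perm (Fin m)) : Fin N →₀ ℕ := ∑ t, Finsupp.single (idx τ t) 1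
  have hdet : (shiftMatrix N w).det =
      ∑ τ : Equiv.Perm (Fin m), ((Equiv.Perm.sign τ : ℤ) : MvPolynomial (Fin N) ℂ) *
        monomial (b τ) 1 := by
    rw [Matrix.det_apply']
    refine Finset.sum_congr rfl fun τ _ => ?_
    rw [monomial_sum_one]
    congr 1
    refine Finset.prod_congr rfl fun t _ => ?_
    rw [shiftMatrix, ← hidx, e_succ]
    rfl
  have hsep (i j : Fin m) (h : i ≤ j) : w i + (j - i : ℕ) ≤ w j := by
    have (n : ℕ) : ∀ j : Fin m, (j : ℕ) = i + n → w i + n ≤ w j := by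
      induction n with
      | zero => intro j hj; rw [show j = i from Fin.ext (by simpa using hj)]; rfl
      | succ n ih =>
        intro j hj
        have := ih ⟨i + n, by omega⟩ rfl
        have : w ⟨i + n, by omega⟩ < w j := hw (Fin.lt_def.mpr (by simp only; omega))
        omega
    exact this _ j (by have := Fin.le_def.mp h; omega)
  have hb (τ : Equiv.Perm (Fin m)) (i : Fin N) :
      b τ i = (Finset.univ.filter fun t => idx τ t = i).card := by
    simp [b, Finsupp.finsetSum_apply, Finsupp.single_apply, Finset.sum_boole]
  refine ⟨∑ τ ∈ Finset.univ.erase 1, ((Equiv.Perm.sign τ : ℤ) : MvPolynomial (Fin N) ℂ) *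
        monomial (b τ) 1, ?_, fun c hc => ?_⟩
  · rw [hdet, ← Finset.add_sum_erase _ _ (Finset.mem_univ 1)]
    simp [b, idx]
  · obtain ⟨τ, hτ, hcτ⟩ := Finset.mem_biUnion.mp (support_sum hc)
    have hcb : c = b τ := by
      have : ((Equiv.Perm.sign τ : ℤ) : MvPolynomial (Fin N) ℂ) * monomial (b τ) 1 =
          monomial (b τ) ((Equiv.Perm.sign τ : ℤ) : ℂ) := by
        rw [← map_intCast (C : ℂ →+* MvPolynomial (Fin N) ℂ), C_mul_monomial, mul_one]
      rw [this] at hcτ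
      simpa using support_monomial_subset hcτ
    subst hcb
    change quadWeight (b τ) < quadWeight (b 1) ∧ ∀ i : Fin N, _ → b τ i ≤ b 1 i
    refine ⟨?_, fun i hi => ?_⟩
    · simp only [b, quadWeight_sum_single, hidx]
      exact sum_perm_add_sq_lt w hw τ (Finset.ne_of_mem_erase hτ)
    · rw [hb, hb]
      refine Finset.card_le_card fun t => ?_
      simp only [Finset.mem_filter, Finset.mem_univ, true_and, Fin.ext_iff]
      have e1 := hidx τ t
      have e2 := hidx 1 t
      simp only [Equiv.Perm.coe_one, id_eq] at e2
      intro h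
      -- Index `1` or `N` can occur only in the top left or bottom right corner of the matrix, since
      -- `w` increases by at least one per column. A term of `τ` using such an entry therefore
      -- shares it with the diagonal term.
      have hm : 0 < m := t.pos
      have f0 := hsep ⟨0, hm⟩ t (Fin.le_def.mpr (by simp))
      have f1 := hsep t ⟨m - 1, by omega⟩ (Fin.le_def.mpr (by simp only; omega))
      have f2 := hN ⟨m - 1, by omega⟩ ⟨m - 1, by omega⟩
      have f3 := h1 ⟨0, hm⟩
      have f4 := (τ t).isLt
      simp only at f0 f1 f2
      rcases hi with hi | hi <;> omega

/-! ### Admissible monomials are linearly independent -/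

/-- The exponents `b` with `b_1 ≤ l`, `b_N ≤ r` and `b_i + b_{i+1} ≤ k`. -/
def IsAdmissible (N k l r : ℕ) (b : Fin N →₀ ℕ) : Prop :=
  (∀ i : Fin N, (i : ℕ) = 0 → b i ≤ l) ∧ (∀ i : Fin N, (i : ℕ) + 1 = N → b i ≤ r) ∧
    ∀ i j : Fin N, (j : ℕ) = i + 1 → b i + b j ≤ k

theorem IsAdmissible.le {N k l r : ℕ} (hN : 2 ≤ N) {b : Fin N →₀ ℕ} (hb : IsAdmissible N k l r b)
    (i : Fin N) : b i ≤ k := by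
  by_cases h : (i : ℕ) + 1 < N
  · have := hb.2.2 i ⟨i + 1, h⟩ rfl
    omega
  · have := hb.2.2 ⟨i - 1, by omega⟩ i (by simp only; omega)
    omega

theorem exists_hasLead_of_nonadjacent {N : ℕ} (B : Finset (Fin N))
    (hB : ∀ i ∈ B, ∀ j ∈ B, (j : ℕ) ≠ i + 1) :
    ∃ P : MvPolynomial (Fin N) ℂ, HasLead P (∑ i ∈ B, Finsupp.single i 1) ∧
      ∀ t : ℂ, (directional fun i : Fin N => t ^ ((i : ℕ) + 1))
        ((directional fun i : Fin N => t ^ ((i : ℕ) + 1)) P) = 0 := by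
  classical
  let ν := B.orderEmbOfFin rfl
  have hsep (n : ℕ) (s t : Fin B.card) (h : (t : ℕ) = s + n) : (ν s : ℕ) + 2 * n ≤ ν t := by
    induction n generalizing t with
    | zero => rw [show t = s from Fin.ext (by simpa using h)]; rfl
    | succ n ih =>
      have h1 := ih ⟨s + n, by omega⟩ rfl
      have h2 : ν ⟨s + n, by omega⟩ < ν t := ν.strictMono (Fin.lt_def.mpr (by simp only; omega))
      have h3 := hB _ (B.orderEmbOfFin_mem rfl ⟨s + n, by omega⟩) _ (B.orderEmbOfFin_mem rfl t)
      have h4 := Fin.lt_def.mp h2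
      simp only [ν] at *
      omega
  have hge (t : Fin B.card) : (t : ℕ) ≤ ν t := by
    have := hsep t ⟨0, t.pos⟩ t (by simp)
    omega
  -- Chosen so that the diagonal entry `e_{t + w_t}` is the variable of the `t`-th element of `B`.
  -- Gaps of at least two in `B` make `w` strictly increasing and keep all indices at most `N`.
  let w (t : Fin B.card) : ℕ := ν t + 1 - t
  have hw : StrictMono w := fun s t hst => by
    have hst := Fin.lt_def.mp hst
    have := hsep (t - s) s t (by omega)
    have := hge s
    simp only [w]
    omega
  have h1 (t) : 1 ≤ w t := by
    have := hge t
    simp only [w]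
    omega
  have hN (s t : Fin B.card) : (s : ℕ) + w t ≤ N := by
    have := hge t
    have := (ν t).isLt
    have := (ν s).isLt
    simp only [w]
    rcases le_total (s : ℕ) t with h | h
    · omega
    · have := hsep (s - t) t s (by omega)
      omega
  refine ⟨(shiftMatrix N w).det, ?_, directional_directional_det_shiftMatrix w h1 hN⟩
  convert hasLead_det_shiftMatrix w hw h1 hN using 1
  have hsum : ∑ i ∈ B, Finsupp.single i 1 = ∑ t, Finsupp.single (ν t) 1 := by
    conv_lhs => rw [← Finset.image_orderEmbOfFin_univ B rfl]
    exact Finset.sum_image fun _ _ _ _ h => ν.injective h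
  rw [hsum]
  refine Finset.sum_congr rfl fun t _ => ?_
  congr 1
  refine Fin.ext ?_
  have := hge t
  simp only [w]
  omega

/-- An admissible exponent is a sum of `k` indicator vectors of sets without neighbours. Each set
gives a determinant killed by `D ^ 2`, so their product is killed by `D ^ (k + 1)`. -/
theorem exists_dual {N k l r : ℕ} (hN : 2 ≤ N) {b : Fin N →₀ ℕ} (hb : IsAdmissible N k l r b) :
    ∃ G : MvPolynomial (Fin N) ℂ, HasLead G b ∧
      ∀ t : ℂ, (directional fun i : Fin N => t ^ ((i : ℕ) + 1))^[k + 1] G = 0 := by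
  classical
  -- Index `i` is put into `b i` of the `k` sets: the first ones for even `i`, the last ones for odd
  -- `i`. Neighbours never share a set because `b i + b (i + 1) ≤ k`.
  let B (a : Fin k) : Finset (Fin N) := Finset.univ.filter fun i =>
    if Even (i : ℕ) then (a : ℕ) < b i else ¬ (a : ℕ) < k - b i
  have hB (a) : ∀ i ∈ B a, ∀ j ∈ B a, (j : ℕ) ≠ i + 1 := by
    intro i hi j hj h
    have := hb.2.2 i j h
    simp only [B, Finset.mem_filter, Finset.mem_univ, true_and, h, Nat.even_add_one] at hi hj
    by_cases he : Even (i : ℕ)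
    · simp only [he, not_true_eq_false, if_true, if_false] at hi hj
      omega
    · simp only [he, not_false_eq_true, if_true, if_false] at hi hj
      omega
  choose P hP hD using fun a => exists_hasLead_of_nonadjacent (B a) (hB a)
  refine ⟨∏ a, P a, ?_, fun t => ?_⟩
  · convert HasLead.prod Finset.univ P _ fun a _ => hP a using 1
    ext i
    have hi := hb.le hN i
    have : (∑ a, ∑ i ∈ B a, Finsupp.single i 1 : Fin N →₀ ℕ) i =
        (Finset.univ.filter fun a : Fin k => i ∈ B a).card := by
      simp [Finsupp.finsetSum_apply, Finsupp.single_apply, Finset.sum_boole]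
    rw [this]
    simp only [B, Finset.mem_filter, Finset.mem_univ, true_and]
    split_ifs with he
    · rw [Fin.card_filter_val_lt, min_eq_right hi]
    · rw [← Finset.compl_filter, Finset.card_compl, Fin.card_filter_val_lt, Fintype.card_fin]
      omega
  · have := derivation_iterate_prod_eq_zero _ P (fun a => hD a t) Finset.univ
    simpa using this

theorem linearIndependent_admissible {N k l r : ℕ} (hN : 2 ≤ N) :
    LinearIndependent ℂ fun b : {b // IsAdmissible N k l r b} =>
      Ideal.Quotient.mkₐ ℂ (idealI N k l r) (monomial b.1 1) := by
  classical
  rw [linearIndependent_iff']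
  intro s g hg
  by_contra! hne
  obtain ⟨b₀, hb₀, hb₀'⟩ := hne
  -- The dual polynomial of `b` contains, besides `e^b`, only lighter monomials. For `b` of least
  -- weight in the relation, it therefore pairs to zero with all other terms.
  obtain ⟨b, hb, hmin⟩ := Finset.exists_min_image (s.filter fun b => g b ≠ 0)
    (fun b => quadWeight b.1) ⟨b₀, by simp [hb₀, hb₀']⟩
  rw [Finset.mem_filter] at hb
  obtain ⟨G, hG, hGD⟩ := exists_dual hN b.2
  have hmem : ∑ c ∈ s, g c • (monomial c.1 (1 : ℂ)) ∈ idealI N k l r := by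
    rw [← Ideal.Quotient.eq_zero_iff_mem, ← Ideal.Quotient.mkₐ_eq_mk ℂ, map_sum, ← hg]
    exact Finset.sum_congr rfl fun c _ => map_smul _ _ _
  have h0 := apolar_eq_zero_of_mem_ideal (by omega) G hGD
    (fun c hc => ((hG.mem_support hc).2 _ (Or.inl rfl)).trans (b.2.1 _ rfl))
    (fun c hc => ((hG.mem_support hc).2 _ (Or.inr (by simp only; omega))).trans
      (b.2.2.1 _ (by simp only; omega))) hmem
  rw [map_sum, LinearMap.sum_apply, Finset.sum_eq_single b] at h0
  · rw [map_smul, LinearMap.smul_apply, apolar_monomial, hG.coeff_self, mul_one, smul_eq_mul,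
      mul_eq_zero] at h0
    rcases h0 with h0 | h0
    · exact hb.2 h0
    · rw [Nat.cast_eq_zero, Finset.prod_eq_zero_iff] at h0
      obtain ⟨i, -, hi⟩ := h0
      exact Nat.factorial_ne_zero _ hi
  · intro c hc hcb
    rw [map_smul, LinearMap.smul_apply, apolar_monomial, smul_eq_mul]
    by_cases hgc : g c = 0
    · rw [hgc, zero_mul]
    · have : coeff c.1 G = 0 := by
        by_contra h
        rcases (hG.mem_support (mem_support_iff.mpr h)).1 with h | h
        · exact hcb (Subtype.ext h)
        · have := hmin c (by simp [hc, hgc])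
          omega
      rw [this, mul_zero, mul_zero]
  · exact fun h => absurd hb.1 h

/-! ### Admissible monomials span -/

/-- The `q`-degree of a monomial. -/
noncomputable def qWeight {N : ℕ} (b : Fin N →₀ ℕ) : ℕ := Finsupp.weight (fun s : Fin N => (s : ℕ) + 1) b

theorem qWeight_eq_sum {N : ℕ} (b : Fin N →₀ ℕ) : qWeight b = ∑ i, b i * ((i : ℕ) + 1) := by
  rw [qWeight, Finsupp.weight_eq_sum]
  rfl

theorem qWeight_add {N : ℕ} (b c : Fin N →₀ ℕ) : qWeight (b + c) = qWeight b + qWeight c :=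
  map_add _ _ _

theorem qWeight_sum_single {N : ℕ} {ι : Type*} (s : Finset ι) (f : ι → Fin N) :
    qWeight (∑ t ∈ s, Finsupp.single (f t) 1) = ∑ t ∈ s, ((f t : ℕ) + 1) := by
  rw [qWeight, map_sum]
  exact Finset.sum_congr rfl fun t _ => by simp [Finsupp.weight_single]

theorem degree_sum_single {N : ℕ} {ι : Type*} (s : Finset ι) (f : ι → Fin N) :
    (∑ t ∈ s, Finsupp.single (f t) 1 : Fin N →₀ ℕ).degree = s.card := by
  rw [map_sum]
  simp

theorem quadWeight_le {N : ℕ} (b : Fin N →₀ ℕ) : quadWeight b ≤ N ^ 2 * b.degree := by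
  rw [Finsupp.degree_eq_sum, Finset.mul_sum]
  refine Finset.sum_le_sum fun i _ => ?_
  rw [mul_comm]
  exact Nat.mul_le_mul_right _ (Nat.pow_le_pow_left i.isLt 2)

/-- Among the exponents with given degree and `q`-degree, the one concentrated on two neighbours has
the smallest weight. -/
theorem quadWeight_lt_of_ne {N : ℕ} {i j : Fin N} (hij : (j : ℕ) = i + 1) {b c : Fin N →₀ ℕ}
    (hc : ∀ s, s ≠ i → s ≠ j → c s = 0) (hdeg : b.degree = c.degree)
    (hwt : qWeight b = qWeight c) (hne : b ≠ c) : quadWeight c < quadWeight b := by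
  by_contra! hle
  -- The function `(s - i)(s - j)` is nonnegative on integers and vanishes only at the neighbours
  -- `i`, `j`. Summed against `f` it is the quadratic weight, up to terms determined by the
  -- bidegree.
  have key (f : Fin N →₀ ℕ) : ∑ s, (f s : ℤ) * (((s : ℤ) - i) * ((s : ℤ) - j)) =
      quadWeight f - (2 * i + 3) * qWeight f + (i + 1) * (i + 2) * f.degree := by
    rw [qWeight_eq_sum, Finsupp.degree_eq_sum, quadWeight]
    push_cast
    rw [Finset.mul_sum, Finset.mul_sum, ← Finset.sum_sub_distrib, ← Finset.sum_add_distrib]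
    refine Finset.sum_congr rfl fun s _ => ?_
    rw [hij]
    push_cast
    ring
  have hij' : i ≠ j := fun h => by rw [h] at hij; omega
  have hnn (s : Fin N) : 0 ≤ ((s : ℤ) - i) * ((s : ℤ) - j) := by
    rw [hij]
    push_cast
    rcases le_or_gt (s : ℤ) i with h | h
    · exact mul_nonneg_of_nonpos_of_nonpos (by omega) (by omega)
    · exact mul_nonneg (by omega) (by omega)
  have hc0 : ∑ s, (c s : ℤ) * (((s : ℤ) - i) * ((s : ℤ) - j)) = 0 := by
    refine Finset.sum_eq_zero fun s _ => ?_
    by_cases h1 : s = i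
    · simp [h1]
    · by_cases h2 : s = j
      · simp [h2]
      · simp [hc s h1 h2]
  have hb0 : ∑ s, (b s : ℤ) * (((s : ℤ) - i) * ((s : ℤ) - j)) = 0 := by
    refine le_antisymm ?_ (Finset.sum_nonneg fun s _ => mul_nonneg (by positivity) (hnn s))
    rw [key] at hc0 ⊢
    rw [hdeg, hwt]
    have : (quadWeight b : ℤ) ≤ quadWeight c := by exact_mod_cast hle
    linarith
  have hb : ∀ s, s ≠ i → s ≠ j → b s = 0 := by
    intro s hi hj
    have := (Finset.sum_eq_zero_iff_of_nonneg fun s _ =>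
      mul_nonneg (by positivity) (hnn s)).mp hb0 s (Finset.mem_univ s)
    rcases mul_eq_zero.mp this with h | h
    · exact_mod_cast h
    · exfalso
      rcases mul_eq_zero.mp h with h | h
      · exact hi (Fin.ext (by omega))
      · exact hj (Fin.ext (by omega))
  have hsum (f : Fin N →₀ ℕ) (hf : ∀ s, s ≠ i → s ≠ j → f s = 0) (g : Fin N → ℕ) :
      ∑ s, f s * g s = f i * g i + f j * g j :=
    Finset.sum_eq_add i j hij' (fun s _ h => by rw [hf s h.1 h.2, zero_mul]) (by simp) (by simp)
  have hd : b i + b j = c i + c j := by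
    rw [Finsupp.degree_eq_sum, Finsupp.degree_eq_sum] at hdeg
    have h1 := hsum b hb fun _ => 1
    have h2 := hsum c hc fun _ => 1
    simp only [mul_one] at h1 h2
    rw [← h1, ← h2, hdeg]
  have hw : b i * (i + 1) + b j * (i + 2) = c i * (i + 1) + c j * (i + 2) := by
    rw [qWeight_eq_sum, qWeight_eq_sum, hsum b hb fun s => (s : ℕ) + 1,
      hsum c hc fun s => (s : ℕ) + 1] at hwt
    simpa [hij, add_assoc] using hwt
  have hbj : b j = c j := by
    have h1 := congrArg (· * ((i : ℕ) + 1)) hd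
    simp only [add_mul] at h1
    have h2 : ∀ x : ℕ, x * ((i : ℕ) + 2) = x * (i + 1) + x := fun x => by ring
    rw [h2, h2] at hw
    omega
  refine hne (Finsupp.ext fun s => ?_)
  by_cases h1 : s = i
  · subst h1; omega
  · by_cases h2 : s = j
    · subst h2; exact hbj
    · rw [hb s h1 h2, hc s h1 h2]

theorem exists_eq_sum_single {σ : Type*} (n : ℕ) (c : σ →₀ ℕ) (hc : c.degree = n) :
    ∃ α : Fin n → σ, ∑ j, Finsupp.single (α j) 1 = c := by
  classical
  induction n generalizing c with
  | zero => exact ⟨Fin.elim0, by simp [(Finsupp.degree_eq_zero_iff c).mp hc]⟩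
  | succ n ih =>
    obtain ⟨s, hs⟩ : ∃ s, c s ≠ 0 := by
      by_contra! h
      rw [show c = 0 from Finsupp.ext h] at hc
      simp at hc
    have hle : Finsupp.single s 1 ≤ c := Finsupp.single_le_iff.mpr (Nat.one_le_iff_ne_zero.mpr hs)
    have heq := add_tsub_cancel_of_le hle
    obtain ⟨α, hα⟩ := ih (c - Finsupp.single s 1) (by
      have := congrArg Finsupp.degree heq
      rw [map_add, Finsupp.degree_single] at this
      omega)
    exact ⟨Fin.cons s α, by simpa [Fin.sum_univ_succ, hα] using heq⟩

theorem currentCoeff_eq_sum (N k i : ℕ) [DecidablePred fun α : Fin (k + 1) → Fin N =>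
    ∑ j, ((α j : ℕ) + 1) = i] :
    currentCoeff N k i = ∑ α : Fin (k + 1) → Fin N with ∑ j, ((α j : ℕ) + 1) = i,
      monomial (∑ j, Finsupp.single (α j) 1) 1 := by
  rw [currentCoeff]
  refine Finset.sum_congr (by congr) fun α _ => ?_
  rw [monomial_sum_one]
  exact Finset.prod_congr rfl fun j _ => e_succ _

/-- The exponents of bidegree `(i, j)` that are admissible. -/
def admissibleSet (N k l r i j : ℕ) : Set (Fin N →₀ ℕ) :=
  {b | IsAdmissible N k l r b ∧ qWeight b = i ∧ b.degree = j}

theorem monomial_mem_of_dvd {N k l r : ℕ} {i : Fin N} {n : ℕ} (h : X i ^ n ∈ idealI N k l r)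
    {b : Fin N →₀ ℕ} (hb : n ≤ b i) : monomial b 1 ∈ idealI N k l r := by
  classical
  rw [← add_tsub_cancel_of_le (Finsupp.single_le_iff.mpr hb),
    show monomial (Finsupp.single i n + (b - Finsupp.single i n)) (1 : ℂ) =
      monomial (b - Finsupp.single i n) 1 * X i ^ n by
        rw [X_pow_eq_monomial, monomial_mul, one_mul, add_comm]]
  exact Ideal.mul_mem_left _ _ h

theorem monomial_mem_sup_span {N k l r : ℕ} (i j : ℕ) (b : Fin N →₀ ℕ)
    (hi : qWeight b = i) (hj : b.degree = j) :
    monomial b 1 ∈ (idealI N k l r).restrictScalars ℂ ⊔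
      Submodule.span ℂ ((fun c => monomial c (1 : ℂ)) '' admissibleSet N k l r i j) := by
  classical
  set U := (idealI N k l r).restrictScalars ℂ ⊔
      Submodule.span ℂ ((fun c => monomial c (1 : ℂ)) '' admissibleSet N k l r i j)
  have hIU {p} (hp : p ∈ idealI N k l r) : p ∈ U := Submodule.mem_sup_left hp
  -- Rewriting raises the weight, which `quadWeight_le` bounds by `N ^ 2 * j`; the induction is on
  -- the remaining room.
  obtain ⟨n, hn⟩ : ∃ n, n = N ^ 2 * j - quadWeight b := ⟨_, rfl⟩
  induction n using Nat.strong_induction_on generalizing b with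
  | _ n ih =>
  by_cases hadm : IsAdmissible N k l r b
  · exact Submodule.mem_sup_right (Submodule.subset_span ⟨b, ⟨hadm, hi, hj⟩, rfl⟩)
  simp only [IsAdmissible, not_and_or, not_forall] at hadm
  rcases hadm with ⟨s, hs, h⟩ | ⟨s, hs, h⟩ | ⟨s, s', hs, h⟩
  · refine hIU (monomial_mem_of_dvd (i := s) (n := l + 1) (Ideal.subset_span (Or.inl ?_))
      (by omega))
    left
    rw [← e_succ, hs]
  · refine hIU (monomial_mem_of_dvd (i := s) (n := r + 1) (Ideal.subset_span (Or.inl ?_))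
      (by omega))
    right
    rw [← e_succ, hs]
    rfl
  have hss : s ≠ s' := fun h => by rw [h] at hs; omega
  -- This selects a divisor `e^c` of `e^b` of degree exactly `k + 1` on the two neighbours, so that
  -- `e^c` occurs in one of the relations.
  let x := min (b s) (k + 1)
  let c : Fin N →₀ ℕ := Finsupp.single s x + Finsupp.single s' (k + 1 - x)
  have hcs : c s = x := by simp [c, hss.symm]
  have hcs' : c s' = k + 1 - x := by simp [c, hss]
  have hc0 (u) (h1 : u ≠ s) (h2 : u ≠ s') : c u = 0 := by simp [c, h1.symm, h2.symm]
  have hcb : c ≤ b := by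
    intro u
    by_cases h1 : u = s
    · subst h1; rw [hcs]; exact min_le_left _ _
    · by_cases h2 : u = s'
      · subst h2; rw [hcs']; simp only [x]; omega
      · rw [hc0 u h1 h2]; exact Nat.zero_le _
  have hcdeg : c.degree = k + 1 := by
    simp only [c, map_add, Finsupp.degree_single, x]
    omega
  clear_value c x
  obtain ⟨d, rfl⟩ := exists_add_of_le hcb
  obtain ⟨α₀, hα₀⟩ := exists_eq_sum_single (k + 1) c hcdeg
  have hwt₀ : ∑ j, ((α₀ j : ℕ) + 1) = qWeight c := by rw [← hα₀, qWeight_sum_single]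
  set F : Finset (Fin (k + 1) → Fin N) :=
    Finset.univ.filter fun α => ∑ j, ((α j : ℕ) + 1) = qWeight c
  have hcur : currentCoeff N k (qWeight c) ∈ idealI N k l r := by
    refine Ideal.subset_span (Or.inr ⟨_, ?_, ?_, rfl⟩)
    · rw [← hwt₀]
      calc k + 1 = ∑ _j : Fin (k + 1), 1 := by simp
        _ ≤ _ := Finset.sum_le_sum fun j _ => by omega
    · rw [← hwt₀]
      calc _ ≤ ∑ _j : Fin (k + 1), N := Finset.sum_le_sum fun j _ => (α₀ j).isLt
        _ = _ := by simp [mul_comm]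
  have hmem : ∑ α ∈ F, monomial ((∑ j, Finsupp.single (α j) 1) + d) (1 : ℂ) ∈ U := by
    have := hIU (Ideal.mul_mem_right (monomial d 1) _ hcur)
    rw [currentCoeff_eq_sum, Finset.sum_mul] at this
    simpa only [monomial_mul, one_mul] using this
  rw [← Finset.sum_filter_add_sum_filter_not F fun α => ∑ j, Finsupp.single (α j) 1 = c] at hmem
  have hrest : ∑ α ∈ F.filter fun α => ¬ ∑ j, Finsupp.single (α j) 1 = c,
      monomial ((∑ j, Finsupp.single (α j) 1) + d) (1 : ℂ) ∈ U := by
    refine Submodule.sum_mem _ fun α hα => ?_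
    obtain ⟨hα, hαc⟩ := Finset.mem_filter.mp hα
    have hα := (Finset.mem_filter.mp hα).2
    set f : Fin N →₀ ℕ := ∑ j, Finsupp.single (α j) 1 with hf
    have hfw : qWeight f = qWeight c := by rw [hf, qWeight_sum_single, hα]
    have hfd : f.degree = c.degree := by rw [hf, degree_sum_single, hcdeg]; simp
    have hlt := quadWeight_lt_of_ne hs hc0 hfd hfw hαc
    have hw : qWeight (f + d) = i := by rw [qWeight_add, hfw, ← qWeight_add, hi]
    have hd : (f + d).degree = j := by rw [map_add, hfd, ← map_add, hj]
    have hle := quadWeight_le (f + d)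
    rw [hd] at hle
    refine ih _ ?_ (f + d) hw hd rfl
    rw [quadWeight_add] at hle hn ⊢
    omega
  have hmain := (Submodule.add_mem_iff_left _ hrest).mp hmem
  rw [Finset.sum_congr rfl (g := fun _ => monomial (c + d) (1 : ℂ))
    (fun α hα => by rw [(Finset.mem_filter.mp hα).2]), Finset.sum_const, ← Nat.cast_smul_eq_nsmul ℂ]
    at hmain
  -- The coefficient of `e^c` in the relation is the number of orderings `α` of its factors,
  -- positive and hence invertible in `ℂ`.
  refine (Submodule.smul_mem_iff _ ?_).mp hmain
  rw [Nat.cast_ne_zero]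
  exact (Finset.card_pos.mpr ⟨α₀, Finset.mem_filter.mpr
    ⟨Finset.mem_filter.mpr ⟨Finset.mem_univ _, hwt₀⟩, hα₀⟩⟩).ne'

theorem bihomogeneous_eq_span (N i j : ℕ) :
    bihomogeneous N i j = Submodule.span ℂ
      ((fun c => monomial c (1 : ℂ)) '' {b : Fin N →₀ ℕ | qWeight b = i ∧ b.degree = j}) := by
  classical
  refine le_antisymm (fun p hp => ?_) (Submodule.span_le.mpr ?_)
  · rw [p.as_sum]
    refine Submodule.sum_mem _ fun c hc => ?_
    rw [show monomial c (coeff c p) = coeff c p • monomial c (1 : ℂ) by simp [smul_monomial]]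
    refine Submodule.smul_mem _ _ (Submodule.subset_span ⟨c, ⟨?_, ?_⟩, rfl⟩)
    · exact hp.1 (mem_support_iff.mp hc)
    · have := hp.2 (mem_support_iff.mp hc)
      rw [Finsupp.degree_eq_weight_one]
      exact this
  · rintro _ ⟨b, ⟨hw, hd⟩, rfl⟩
    exact ⟨isWeightedHomogeneous_monomial _ _ _ hw, isHomogeneous_monomial _ hd⟩

theorem component_eq_span (N k l r i j : ℕ) :
    component N k l r i j = Submodule.span ℂ (Set.range fun b : admissibleSet N k l r i j =>
      Ideal.Quotient.mkₐ ℂ (idealI N k l r) (monomial b.1 1)) := by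
  set π := (Ideal.Quotient.mkₐ ℂ (idealI N k l r)).toLinearMap
  have hset : (Set.range fun b : admissibleSet N k l r i j =>
      Ideal.Quotient.mkₐ ℂ (idealI N k l r) (monomial b.1 1)) =
      π '' ((fun c => monomial c (1 : ℂ)) '' admissibleSet N k l r i j) := by
    ext x
    simp [π]
  rw [hset, ← Submodule.map_span, component, bihomogeneous_eq_span]
  refine le_antisymm ?_ (Submodule.map_mono (Submodule.span_mono (Set.image_mono fun b hb => hb.2)))
  rw [Submodule.map_span_le]
  rintro _ ⟨b, ⟨hw, hd⟩, rfl⟩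
  obtain ⟨p, hp, x, hx, h⟩ := Submodule.mem_sup.mp
    (monomial_mem_sup_span (k := k) (l := l) (r := r) i j b hw hd)
  refine ⟨x, hx, ?_⟩
  simp only
  rw [← h, map_add]
  have : π p = 0 := Ideal.Quotient.eq_zero_iff_mem.mpr hp
  rw [this, zero_add]

theorem finrank_component {N k l r : ℕ} (hN : 2 ≤ N) (i j : ℕ) :
    Module.finrank ℂ (component N k l r i j) = Nat.card (admissibleSet N k l r i j) := by
  have : Finite (admissibleSet N k l r i j) :=
    (Finsupp.finite_of_degree_eq j).subset fun b hb => hb.2.2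
  have := Fintype.ofFinite (admissibleSet N k l r i j)
  rw [component_eq_span, Nat.card_eq_fintype_card]
  refine finrank_span_eq_card ?_
  exact (linearIndependent_admissible hN).comp
    (fun b : admissibleSet N k l r i j => (⟨b.1, b.2.1⟩ : {b // IsAdmissible N k l r b}))
    fun b c h => Subtype.ext (Subtype.mk.inj h)

/-! ### The vertex contributions as rational functions -/

section Field

variable {K : Type*} [Field K]

/-- Elements `q`, `z` of a field for which all the denominators below are nonzero. -/
structure Generic (q z : K) : Prop where
  q_ne : q ≠ 0
  z_ne : z ≠ 0
  q_pow : ∀ i : ℕ, 1 ≤ i → 1 - q ^ i ≠ 0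
  q_pow_z : ∀ i : ℕ, 1 ≤ i → 1 - q ^ i * z ≠ 0

/-- The variable `q ^ i * z` attached to the `i`-th coordinate. -/
def coordVar (q z : K) (i : ℕ) : K := q ^ i * z

/-- The quotient of the denominators of the left ends of length `m` and `m - 1`. -/
def leftDelta (q z : K) (s m : ℕ) : K :=
  if Even m then 1 - q ^ (m / 2) else 1 - (coordVar q z ((m + 1) / 2 + s))⁻¹

/-- The contribution of the left end `(l, k - l, l, …)` of length `m`, at the coordinates
`s + 1, …, s + m`. -/
def leftEnd (q z : K) (k : ℕ) : ℕ → ℕ → ℕ → K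
  | 0, _, _ => 1
  | m + 1, s, l =>
      coordVar q z (s + 1) ^ l * leftEnd q z k m (s + 1) (k - l) / leftDelta q z s (m + 1)

/-- The contribution of the zero coordinates `a + 1, …, b`. -/
def middle (q z : K) (a b : ℕ) : K := ∏ i ∈ Finset.Ioc a b, (1 - coordVar q z i)⁻¹

/-- The contributions of the parts of the vertices in the coordinates `s + 1, …, s + T`, where
the full left end `m = T` is taken only if `T` has the parity of `p`. -/
def leftSum (q z : K) (k p s T l : ℕ) : K :=
  ∑ m ∈ Finset.range T, leftEnd q z k m s l * middle q z (s + m) (s + T) +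
    if T % 2 = p % 2 then leftEnd q z k T s l else 0

variable {q z : K} {k : ℕ}

/-! ### Recursion of the left ends in `l`, and their behaviour at `l = 0` -/

theorem Generic.coordVar_ne (h : Generic q z) (i : ℕ) : coordVar q z i ≠ 0 :=
  mul_ne_zero (pow_ne_zero _ h.q_ne) h.z_ne

theorem Generic.one_sub_inv_ne (h : Generic q z) {i : ℕ} (hi : 1 ≤ i) :
    1 - (coordVar q z i)⁻¹ ≠ 0 := by
  intro h0
  apply h.q_pow_z i hi
  change 1 - coordVar q z i = 0
  rw [sub_eq_zero] at h0 ⊢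
  rw [← inv_inv (coordVar q z i), ← h0, inv_one]

theorem coordVar_add (q z : K) (i j : ℕ) : coordVar q z (i + j) = q ^ j * coordVar q z i := by
  unfold coordVar
  ring

theorem leftDelta_even (s a : ℕ) : leftDelta q z s (2 * a) = 1 - q ^ a := by
  simp [leftDelta]

theorem leftDelta_odd (s a : ℕ) :
    leftDelta q z s (2 * a + 1) = 1 - (coordVar q z (a + 1 + s))⁻¹ := by
  rw [leftDelta, if_neg (by simp [parity_simps]), show (2 * a + 1 + 1) / 2 = a + 1 by omega]

theorem Generic.leftDelta_ne (h : Generic q z) (s : ℕ) {m : ℕ} (hm : 1 ≤ m) :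
    leftDelta q z s m ≠ 0 := by
  rcases Nat.even_or_odd' m with ⟨a, rfl | rfl⟩
  · rw [leftDelta_even]
    exact h.q_pow a (by omega)
  · rw [leftDelta_odd]
    exact h.one_sub_inv_ne (by omega)

theorem leftEnd_mul_leftDelta (h : Generic q z) (m s l : ℕ) :
    leftEnd q z k (m + 1) s l * leftDelta q z s (m + 1) =
      coordVar q z (s + 1) ^ l * leftEnd q z k m (s + 1) (k - l) := by
  rw [leftEnd, div_mul_cancel₀ _ (h.leftDelta_ne s (by omega))]

/-- Increasing `l` multiplies the left end by a factor `ρ` with `1 - ρ⁻¹ = leftDelta`. -/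
theorem leftEnd_succ_mul (h : Generic q z) (m : ℕ) : ∀ (s l : ℕ), l + 1 ≤ k →
    leftEnd q z k m s (l + 1) * (1 - leftDelta q z s m) = leftEnd q z k m s l := by
  induction m with
  | zero => intro s l _; simp [leftEnd, leftDelta]
  | succ m ih =>
    intro s l hl
    have h1 := ih (s + 1) (k - (l + 1)) (by omega)
    rw [show k - (l + 1) + 1 = k - l by omega] at h1
    have hd := h.leftDelta_ne s (m := m + 1) (by omega)
    rw [leftEnd, leftEnd, ← h1]
    have hy := h.coordVar_ne (s + 1)
    have hq := h.q_ne
    -- Raising `l` multiplies the first coordinate's monomial by `coordVar q z (s + 1)` and lowers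
    -- the bound `k - l` of the shorter end. The ratios for lengths `m` and `m + 1` must therefore
    -- satisfy this relation.
    have hrel : coordVar q z (s + 1) * (1 - leftDelta q z (s + 1) m) *
        (1 - leftDelta q z s (m + 1)) = 1 := by
      rcases Nat.even_or_odd' m with ⟨a, rfl | rfl⟩
      · rw [leftDelta_odd, leftDelta_even, show a + 1 + s = s + 1 + a by ring,
          coordVar_add q z (s + 1) a]
        field_simp
        ring
      · rw [leftDelta_odd, show 2 * a + 1 + 1 = 2 * (a + 1) by ring, leftDelta_even,
          show a + 1 + (s + 1) = s + 1 + (a + 1) by ring, coordVar_add q z (s + 1) (a + 1)]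
        field_simp
        ring
    rw [pow_succ]
    linear_combination (coordVar q z (s + 1) ^ l * leftEnd q z k m (s + 1) (k - l) /
      leftDelta q z s (m + 1)) * hrel

/-- The difference is the value at `l + 1` times `leftDelta`, which cancels the last denominator in
the definition of `leftEnd`. -/
theorem leftEnd_succ_sub (h : Generic q z) (m s l : ℕ) (hl : l + 1 ≤ k) :
    leftEnd q z k (m + 1) s (l + 1) - leftEnd q z k (m + 1) s l =
      coordVar q z (s + 1) ^ (l + 1) * leftEnd q z k m (s + 1) (k - (l + 1)) := by
  rw [← leftEnd_mul_leftDelta h, ← leftEnd_succ_mul h (m + 1) s l hl]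
  ring

/-- The term `m = 0` does not depend on `l` and cancels; the term `m + 1` becomes the term `m` with
the first coordinate removed. Shifting `T` and `p` together preserves the parity condition. -/
theorem leftSum_succ_sub (h : Generic q z) (p s T l : ℕ) (hl : l + 1 ≤ k) :
    leftSum q z k (p + 1) s (T + 1) (l + 1) - leftSum q z k (p + 1) s (T + 1) l =
      coordVar q z (s + 1) ^ (l + 1) * leftSum q z k p (s + 1) T (k - (l + 1)) := by
  unfold leftSum
  rw [Finset.sum_range_succ', Finset.sum_range_succ', mul_add, Finset.mul_sum]
  have h0 : leftEnd q z k 0 s (l + 1) = leftEnd q z k 0 s l := rfl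
  have h1 : ∑ m ∈ Finset.range T, leftEnd q z k (m + 1) s (l + 1) *
      middle q z (s + (m + 1)) (s + (T + 1)) - ∑ m ∈ Finset.range T, leftEnd q z k (m + 1) s l *
      middle q z (s + (m + 1)) (s + (T + 1)) = ∑ m ∈ Finset.range T, coordVar q z (s + 1) ^ (l + 1) *
      (leftEnd q z k m (s + 1) (k - (l + 1)) * middle q z (s + 1 + m) (s + 1 + T)) := by
    rw [← Finset.sum_sub_distrib]
    refine Finset.sum_congr rfl fun m _ => ?_
    rw [← sub_mul, leftEnd_succ_sub h m s l hl, show s + (m + 1) = s + 1 + m by ring,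
      show s + (T + 1) = s + 1 + T by ring, mul_assoc]
  rw [h0, ← h1]
  by_cases hp : T % 2 = p % 2
  · have hp' : (T + 1) % 2 = (p + 1) % 2 := by omega
    rw [if_pos hp, if_pos hp', if_pos hp', ← leftEnd_succ_sub h T s l hl]
    ring
  · have hp' : ¬ (T + 1) % 2 = (p + 1) % 2 := by omega
    rw [if_neg hp, if_neg hp', if_neg hp']
    ring

/-- For `l = 0` an odd left end finishes with a zero coordinate, so dropping that coordinate changes
only one denominator. As `leftEnd` is built from the left, the induction removes two coordinates at
a time. -/
theorem leftEnd_odd_zero (h : Generic q z) (a : ℕ) : ∀ s : ℕ,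
    leftEnd q z k (2 * a + 1) s 0 * (1 - (coordVar q z (s + 2 * a + 1))⁻¹) =
      leftEnd q z k (2 * a) s 0 := by
  induction a with
  | zero =>
    intro s
    have := leftEnd_mul_leftDelta (k := k) h 0 s 0
    rw [show 0 + 1 = 2 * 0 + 1 by rfl, leftDelta_odd] at this
    simpa [add_comm s 1, leftEnd] using this
  | succ a ih =>
    intro s
    have h1 := ih (s + 2)
    have e1 := leftEnd_mul_leftDelta (k := k) h (2 * a + 2) s 0
    have e2 := leftEnd_mul_leftDelta (k := k) h (2 * a + 1) (s + 1) k
    have e3 := leftEnd_mul_leftDelta (k := k) h (2 * a + 1) s 0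
    have e4 := leftEnd_mul_leftDelta (k := k) h (2 * a) (s + 1) k
    rw [show 2 * a + 2 + 1 = 2 * (a + 1) + 1 by ring, leftDelta_odd] at e1
    rw [show 2 * a + 1 + 1 = 2 * (a + 1) by ring, leftDelta_even] at e2 e3
    rw [leftDelta_odd] at e4
    simp only [pow_zero, one_mul, Nat.sub_zero, Nat.sub_self,
      show 2 * a + 2 = 2 * (a + 1) by ring, show a + 1 + (s + 1) = a + 1 + 1 + s by ring,
      show s + 1 + 1 = s + 2 by ring] at e1 e2 e3 e4
    rw [show s + 2 + 2 * a + 1 = s + 2 * (a + 1) + 1 by ring] at h1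
    have n1 := h.one_sub_inv_ne (i := a + 1 + 1 + s) (by omega)
    have n2 := h.q_pow (a + 1) (by omega)
    apply mul_right_cancel₀ n1
    apply mul_right_cancel₀ n2
    linear_combination (1 - (coordVar q z (s + 2 * (a + 1) + 1))⁻¹) * (1 - q ^ (a + 1)) * e1 +
      (1 - (coordVar q z (s + 2 * (a + 1) + 1))⁻¹) * e2 -
      (1 - (coordVar q z (a + 1 + 1 + s))⁻¹) * e3 - e4 + coordVar q z (s + 2) ^ k * h1

theorem middle_eq_mul {a b : ℕ} (hab : a < b) :
    middle q z a b = (1 - coordVar q z (a + 1))⁻¹ * middle q z (a + 1) b := by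
  unfold middle
  rw [← Finset.prod_Ioc_consecutive _ (Nat.le_succ a) hab, Nat.Ioc_succ_singleton,
    Finset.prod_singleton]

theorem Generic.one_sub_ne (h : Generic q z) {i : ℕ} (hi : 1 ≤ i) : 1 - coordVar q z i ≠ 0 :=
  h.q_pow_z i hi

/-- The other two ends are both multiples of the one of length `2 * a + 1`. What remains is a
rational identity based on `coordVar_add`. -/
theorem leftEnd_zero_relation (h : Generic q z) (a s : ℕ) :
    leftEnd q z k (2 * a) s 0 * q ^ a * (1 - coordVar q z (s + 2 * a + 1))⁻¹ +
      leftEnd q z k (2 * a + 1) s 0 - leftEnd q z k (2 * a) (s + 1) k = 0 := by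
  have e1 := leftEnd_mul_leftDelta (k := k) h (2 * a) s 0
  rw [leftDelta_odd] at e1
  simp only [pow_zero, one_mul, Nat.sub_zero] at e1
  rw [← e1, ← leftEnd_odd_zero h a s, show s + 2 * a + 1 = a + 1 + s + a by ring,
    coordVar_add q z (a + 1 + s) a]
  have h1 := h.one_sub_ne (i := a + 1 + s + a) (by omega)
  rw [coordVar_add] at h1
  have h2 := h.coordVar_ne (a + 1 + s)
  have h3 := h.q_ne
  field_simp
  ring

/-- The partial sums of the two sides of the recursion at `l = 0`. -/
theorem partial_sum_sub (h : Generic q z) (s T a : ℕ) (ha : 2 * a ≤ T) :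
    (∑ m ∈ Finset.range (2 * a + 1), leftEnd q z k m s 0 * middle q z (s + m) (s + (T + 1)) -
      ∑ m ∈ Finset.range (2 * a), leftEnd q z k m (s + 1) k *
        middle q z (s + 1 + m) (s + 1 + T)) =
      leftEnd q z k (2 * a) s 0 * q ^ a * middle q z (s + 2 * a) (s + (T + 1)) := by
  induction a with
  | zero => simp
  | succ a ih =>
    have ih := ih (by omega)
    have e1 := leftEnd_mul_leftDelta (k := k) h (2 * a + 1) s 0
    rw [show 2 * a + 1 + 1 = 2 * (a + 1) by ring, leftDelta_even] at e1
    simp only [pow_zero, one_mul, Nat.sub_zero] at e1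
    have e2 := leftEnd_zero_relation (k := k) h a s
    have e3 := middle_eq_mul (q := q) (z := z) (show s + 2 * a < s + (T + 1) by omega)
    rw [Finset.sum_range_succ, show 2 * (a + 1) = 2 * a + 1 + 1 by ring,
      Finset.sum_range_succ _ (2 * a + 1), Finset.sum_range_succ _ (2 * a + 1),
      Finset.sum_range_succ _ (2 * a)]
    rw [Finset.sum_range_succ] at ih
    simp only [show s + 1 + (2 * a + 1) = s + 2 * a + 1 + 1 by ring,
      show s + (2 * a + 1 + 1) = s + 2 * a + 1 + 1 by ring,
      show s + (2 * a + 1) = s + 2 * a + 1 by ring,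
      show s + 1 + T = s + (T + 1) by ring, show 2 * (a + 1) = 2 * a + 1 + 1 by ring]
      at ih e1 e2 e3 ⊢
    rw [Finset.sum_range_succ, show s + 1 + 2 * a = s + 2 * a + 1 by ring]
    -- The new terms of index `2a + 1` on the left and `2a` on the right absorb the old residue. The
    -- next pair leaves the residue with `q ^ (a + 1)`.
    linear_combination ih + e2 * middle q z (s + 2 * a + 1) (s + (T + 1)) +
      e1 * middle q z (s + 2 * a + 1 + 1) (s + (T + 1)) + leftEnd q z k (2 * a) s 0 * q ^ a * e3

/-- For `l = 0` the first coordinate is forced to vanish and the second is bounded only by `k`. The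
partial sums telescope, and the last terms cancel the final residue. -/
theorem leftSum_zero (h : Generic q z) (s T : ℕ) :
    leftSum q z k 1 s (T + 1) 0 = leftSum q z k 0 (s + 1) T k := by
  unfold leftSum
  rcases Nat.even_or_odd' T with ⟨a, rfl | rfl⟩
  · have e1 := partial_sum_sub (k := k) h s (2 * a) a le_rfl
    have e2 := leftEnd_zero_relation (k := k) h a s
    have e3 := middle_eq_mul (q := q) (z := z) (show s + 2 * a < s + 2 * a + 1 by omega)
    rw [if_pos (by omega), if_pos (by omega)]
    simp only [← add_assoc] at e1 ⊢
    have e4 : middle q z (s + 2 * a + 1) (s + 2 * a + 1) = 1 := by simp [middle]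
    rw [e4, mul_one] at e3
    linear_combination e1 + e2 + leftEnd q z k (2 * a) s 0 * q ^ a * e3
  · have e1 := partial_sum_sub (k := k) h s (2 * a + 1) a (by omega)
    have e2 := leftEnd_zero_relation (k := k) h a s
    have e3 := middle_eq_mul (q := q) (z := z) (show s + 2 * a < s + (2 * a + 1 + 1) by omega)
    rw [if_neg (by omega), if_neg (by omega), Finset.sum_range_succ _ (2 * a + 1),
      Finset.sum_range_succ (fun m => leftEnd q z k m (s + 1) k * _) (2 * a)]
    simp only [show s + 1 + (2 * a + 1) = s + (2 * a + 1 + 1) by ring,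
      show s + 1 + 2 * a = s + 2 * a + 1 by ring,
      show s + (2 * a + 1) = s + 2 * a + 1 by ring] at e1 ⊢
    linear_combination e1 + e2 * middle q z (s + 2 * a + 1) (s + (2 * a + 1 + 1)) +
      leftEnd q z k (2 * a) s 0 * q ^ a * e3

/-- The contribution of the right end `(…, r, k - r, r)` of length `n`, at the coordinates
`S - n + 1, …, S`. -/
def rightEnd (q z : K) (k S n r : ℕ) : K :=
  (∏ j ∈ Finset.range n, coordVar q z (S - j) ^ (if Even j then r else k - r)) /
    ((∏ i ∈ Finset.Icc 1 (n / 2), (1 - (q ^ i)⁻¹)) *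
      ∏ i ∈ Finset.Icc (n / 2 + 1) n, (1 - (coordVar q z (S + 1 - i))⁻¹))

/-- The sum of the contributions of the simple vertices at the coordinates `s + 1, …, s + N`, where
those with no zero coordinates are taken only for `m` of the parity of `p`. -/
def vertexSum (q z : K) (k r p s N l : ℕ) : K :=
  ∑ n ∈ Finset.range (N + 1), rightEnd q z k (s + N) n r * leftSum q z k p s (N - n) l

/-! ### Vertex sums and lattice point sums satisfy the same recursion -/

variable {r : ℕ}

theorem vertexSum_succ_sub (h : Generic q z) (p s N l : ℕ) (hl : l + 1 ≤ k) :
    vertexSum q z k r (p + 1) s (N + 1) (l + 1) - vertexSum q z k r (p + 1) s (N + 1) l =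
      coordVar q z (s + 1) ^ (l + 1) * vertexSum q z k r p (s + 1) N (k - (l + 1)) := by
  unfold vertexSum
  rw [Finset.sum_range_succ _ (N + 1), Finset.sum_range_succ _ (N + 1)]
  have h0 : leftSum q z k (p + 1) s (N + 1 - (N + 1)) (l + 1) =
      leftSum q z k (p + 1) s (N + 1 - (N + 1)) l := by
    simp [leftSum, leftEnd]
  rw [h0, add_sub_add_right_eq_sub, ← Finset.sum_sub_distrib, Finset.mul_sum]
  refine Finset.sum_congr rfl fun n hn => ?_
  have hn := Finset.mem_range_succ_iff.mp hn
  rw [← mul_sub, Nat.succ_sub hn, leftSum_succ_sub h p s (N - n) l hl,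
    show s + (N + 1) = s + 1 + N by ring]
  ring

theorem vertexSum_zero (h : Generic q z) (s N : ℕ) :
    vertexSum q z k r 1 s (N + 1) 0 = vertexSum q z k r 0 (s + 1) N k := by
  unfold vertexSum
  rw [Finset.sum_range_succ _ (N + 1)]
  -- An empty left end has even length, so it is absent from the odd sum.
  have h0 : leftSum q z k 1 s (N + 1 - (N + 1)) 0 = 0 := by simp [leftSum]
  rw [h0, mul_zero, add_zero]
  refine Finset.sum_congr rfl fun n hn => ?_
  have hn := Finset.mem_range_succ_iff.mp hn
  rw [Nat.succ_sub hn, leftSum_zero h s (N - n), show s + (N + 1) = s + 1 + N by ring]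

/-- The generating function of the admissible exponents at the coordinates `s + 1, …, s + N`. -/
def latticeSum (q z : K) (k r : ℕ) : ℕ → ℕ → ℕ → K
  -- When the recursion arrives here, `l` is `k - b_N`, so the test is the bound `b_N ≤ r`.
  | 0, _, l => if k ≤ l + r then 1 else 0
  | N + 1, s, l =>
      ∑ j ∈ Finset.range (l + 1), coordVar q z (s + 1) ^ j * latticeSum q z k r N (s + 1) (k - j)

theorem latticeSum_succ (N s l : ℕ) : latticeSum q z k r (N + 1) s (l + 1) =
    latticeSum q z k r (N + 1) s l +
      coordVar q z (s + 1) ^ (l + 1) * latticeSum q z k r N (s + 1) (k - (l + 1)) := by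
  rw [latticeSum, Finset.sum_range_succ, latticeSum]

/-- On the wall between the two cases of the theorem, both sums of contributions agree. -/
def WallIdentity (q z : K) (k r : ℕ) : Prop :=
  ∀ N s l : ℕ, l ≤ k → 1 ≤ N → ((Odd N ∧ l = r) ∨ (Even N ∧ l + r = k)) →
    vertexSum q z k r 0 s N l = vertexSum q z k r 1 s N l

theorem vertexSum_add_two (p s N l : ℕ) :
    vertexSum q z k r (p + 2) s N l = vertexSum q z k r p s N l := by
  simp [vertexSum, leftSum]

/-- Double induction on `N` and `l`: the odd sum climbs from `l = 0` to the wall, where `hwall`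
switches to the even sum. Passing to `k - (l + 1)` in one dimension less exchanges the two regions.
The case `N = 0` needs the strict inequality, since there the wall identity fails: the even sum is
`1` and the odd sum is `0`. -/
theorem latticeSum_eq (h : Generic q z) (hr : r ≤ k) (hwall : WallIdentity q z k r) (N : ℕ) :
    ∀ s l : ℕ, l ≤ k →
      (((Odd N ∧ r ≤ l) ∨ (Even N ∧ k ≤ l + r)) →
        latticeSum q z k r N s l = vertexSum q z k r 0 s N l) ∧
      (((Odd N ∧ l ≤ r) ∨ (Even N ∧ l + r < k) ∨ (Even N ∧ 1 ≤ N ∧ l + r ≤ k)) →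
        latticeSum q z k r N s l = vertexSum q z k r 1 s N l) := by
  induction N with
  | zero =>
    intro s l _
    have h1 : vertexSum q z k r 0 s 0 l = 1 := by
      simp [vertexSum, rightEnd, leftSum, leftEnd]
    have h2 : vertexSum q z k r 1 s 0 l = 0 := by
      simp [vertexSum, rightEnd, leftSum]
    rw [h1, h2, latticeSum]
    refine ⟨fun hc => if_pos ?_, fun hc => if_neg ?_⟩
    · simpa using hc
    · have : l + r < k := by simpa using hc
      omega
  | succ N ih =>
    have hpar := Nat.even_or_odd N
    simp only [Nat.odd_add_one, Nat.even_add_one, Nat.not_odd_iff_even, Nat.not_even_iff_odd]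
    have hodd (s l : ℕ) (hl : l ≤ k) (hc : (Even N ∧ l ≤ r) ∨ (Odd N ∧ l + r ≤ k)) :
        latticeSum q z k r (N + 1) s l = vertexSum q z k r 1 s (N + 1) l := by
      induction l with
      | zero =>
        rw [vertexSum_zero h, latticeSum]
        simp only [zero_add, Finset.range_one, Finset.sum_singleton, pow_zero, one_mul,
          Nat.sub_zero]
        refine (ih (s + 1) k le_rfl).1 ?_
        rcases hpar with hp | hp
        · exact Or.inr ⟨hp, by omega⟩
        · exact Or.inl ⟨hp, hr⟩
      | succ l ihl =>
        have h1 := vertexSum_succ_sub (r := r) h 0 s N l hl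
        rw [latticeSum_succ, ihl (by omega) (hc.imp (fun h => ⟨h.1, by omega⟩)
          fun h => ⟨h.1, by omega⟩), (ih (s + 1) (k - (l + 1)) (by omega)).1, ← h1]
        · simp
        · rcases hc with hc | hc
          · exact Or.inr ⟨hc.1, by omega⟩
          · exact Or.inl ⟨hc.1, by omega⟩
    intro s l hl
    refine ⟨fun hc => ?_, fun hc => hodd s l hl ?_⟩
    · obtain ⟨w, hw, hwl⟩ : ∃ w, ((Even N ∧ w = r) ∨ (Odd N ∧ w + r = k)) ∧ w ≤ l := by
        rcases hc with hc | hc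
        · exact ⟨r, Or.inl ⟨hc.1, rfl⟩, hc.2⟩
        · exact ⟨k - r, Or.inr ⟨hc.1, by omega⟩, by omega⟩
      induction l, hwl using Nat.le_induction with
      | base =>
        rw [hodd s w hl (hw.imp (fun h => ⟨h.1, by omega⟩) fun h => ⟨h.1, by omega⟩)]
        refine (hwall (N + 1) s w hl (by omega) ?_).symm
        simpa only [Nat.odd_add_one, Nat.even_add_one, Nat.not_odd_iff_even,
          Nat.not_even_iff_odd] using hw
      | succ l hwl ihl =>
        have h1 := vertexSum_succ_sub (r := r) h 1 s N l hl
        rw [vertexSum_add_two, vertexSum_add_two] at h1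
        rw [latticeSum_succ, ihl (by omega) (hw.imp (fun h => ⟨h.1, by omega⟩)
          fun h => ⟨h.1, by omega⟩), (ih (s + 1) (k - (l + 1)) (by omega)).2, ← h1]
        · ring
        · rcases hw with hw | hw
          · exact Or.inr (Or.inl ⟨hw.1, by omega⟩)
          · exact Or.inl ⟨hw.1, by omega⟩
    · rcases hc with hc | hc | hc
      · exact Or.inl hc
      · exact Or.inr ⟨hc.1, by omega⟩
      · exact Or.inr ⟨hc.1, by omega⟩

/-! ### Closed form of the left end -/

/-- The denominator of the left end. -/
def leftDenom (q z : K) (m s : ℕ) : K :=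
  (∏ i ∈ Finset.Icc 1 (m / 2), (1 - q ^ i)) *
    ∏ i ∈ Finset.Icc (m / 2 + 1) m, (1 - (coordVar q z (s + i))⁻¹)

/-- After the shift of `s`, the two coordinate ranges differ by their lowest member for `m` even and
coincide for `m` odd, where a factor `1 - q ^ i` is new instead. -/
theorem leftDenom_succ (m s : ℕ) :
    leftDenom q z (m + 1) s = leftDenom q z m (s + 1) * leftDelta q z s (m + 1) := by
  unfold leftDenom
  rcases Nat.even_or_odd' m with ⟨a, rfl | rfl⟩
  · rw [leftDelta_odd, show (2 * a + 1) / 2 = a by omega, show 2 * a / 2 = a by omega, mul_assoc]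
    congr 1
    rw [← Finset.mul_prod_Ioc_eq_prod_Icc (by omega : a + 1 ≤ 2 * a + 1), mul_comm]
    congr 1
    · rw [← Finset.Icc_add_one_left_eq_Ioc, ← Finset.image_add_right_Icc (a + 1) (2 * a) 1,
        Finset.prod_image fun _ _ _ _ h => by simpa using h]
      exact Finset.prod_congr rfl fun i _ => by rw [show s + (i + 1) = s + 1 + i by ring]
    · rw [show s + (a + 1) = a + 1 + s by ring]
  · rw [show 2 * a + 1 + 1 = 2 * (a + 1) by ring, leftDelta_even,
      show (2 * a + 1) / 2 = a by omega, show 2 * (a + 1) / 2 = a + 1 by omega,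
      Finset.prod_Icc_succ_top (by omega : 1 ≤ a + 1), mul_right_comm]
    congr 2
    rw [show 2 * (a + 1) = 2 * a + 1 + 1 by ring,
      ← Finset.image_add_right_Icc (a + 1) (2 * a + 1) 1,
      Finset.prod_image fun _ _ _ _ h => by simpa using h]
    exact Finset.prod_congr rfl fun i _ => by rw [show s + (i + 1) = s + 1 + i by ring]

theorem leftEnd_eq (m : ℕ) : ∀ s l : ℕ, l ≤ k → leftEnd q z k m s l =
    (∏ j ∈ Finset.Icc 1 m, coordVar q z (s + j) ^ (if Odd j then l else k - l)) /
      leftDenom q z m s := by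
  induction m with
  | zero => intro s l _; simp [leftEnd, leftDenom]
  | succ m ih =>
    intro s l hl
    rw [leftEnd, ih (s + 1) (k - l) (by omega), leftDenom_succ,
      ← Finset.mul_prod_Ioc_eq_prod_Icc (by omega : 1 ≤ m + 1),
      ← Finset.Icc_add_one_left_eq_Ioc, ← Finset.image_add_right_Icc 1 m 1,
      Finset.prod_image fun _ _ _ _ h => by simpa using h, if_pos odd_one, mul_div_assoc', div_div]
    congr 2
    refine Finset.prod_congr rfl fun j _ => ?_
    rw [show s + (j + 1) = s + 1 + j by ring]
    congr 1
    by_cases hj : Odd j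
    · simp [hj, Nat.odd_add_one]
    · rw [if_neg hj, if_pos (Nat.odd_add_one.mpr hj)]
      omega

/-! ### The identity on the wall -/

theorem leftSum_zero_sub_one (s T l : ℕ) :
    leftSum q z k 0 s T l - leftSum q z k 1 s T l = (-1) ^ T * leftEnd q z k T s l := by
  unfold leftSum
  rcases Nat.even_or_odd T with h | h
  · rw [if_pos (by have := Nat.even_iff.mp h; omega),
      if_neg (by have := Nat.even_iff.mp h; omega), h.neg_one_pow]
    ring
  · rw [if_neg (by have := Nat.odd_iff.mp h; omega),
      if_pos (by have := Nat.odd_iff.mp h; omega), h.neg_one_pow]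
    ring

/-- Only vertices without zero coordinates distinguish the two sums, and each enters with the sign
of its parity. -/
theorem vertexSum_zero_sub_one (s N l : ℕ) :
    vertexSum q z k r 0 s N l - vertexSum q z k r 1 s N l =
      ∑ m ∈ Finset.range (N + 1),
        (-1) ^ m * (rightEnd q z k (s + N) (N - m) r * leftEnd q z k m s l) := by
  unfold vertexSum
  rw [← Finset.sum_sub_distrib, ← Finset.sum_range_reflect]
  refine Finset.sum_congr rfl fun m hm => ?_
  have hm := Finset.mem_range_succ_iff.mp hm
  rw [← mul_sub, leftSum_zero_sub_one, show N - (N + 1 - 1 - m) = m by omega,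
    show N + 1 - 1 - m = N - m by omega]
  ring

/-- The denominator of the right end. -/
def rightDenom (q z : K) (S n : ℕ) : K :=
  (∏ i ∈ Finset.Icc 1 (n / 2), (1 - (q ^ i)⁻¹)) *
    ∏ i ∈ Finset.Icc (n / 2 + 1) n, (1 - (coordVar q z (S + 1 - i))⁻¹)

/-- On the wall the patterns `l, k - l, …` and `…, k - r, r` agree coordinate by coordinate. All
vertices with `m + n = N` are then one point, and only the denominators depend on `m`. -/
theorem right_mul_left_wall {N s l m : ℕ} (hl : l ≤ k)
    (h : (Odd N ∧ l = r) ∨ (Even N ∧ l + r = k)) (hm : m ≤ N) :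
    rightEnd q z k (s + N) (N - m) r * leftEnd q z k m s l =
      (∏ j ∈ Finset.Icc 1 N, coordVar q z (s + j) ^ (if Odd j then l else k - l)) *
        (leftDenom q z m s * rightDenom q z (s + N) (N - m))⁻¹ := by
  rw [leftEnd_eq m s l hl, rightEnd, div_mul_div_comm, div_eq_mul_inv]
  congr 1
  · rw [mul_comm, Finset.range_eq_Ico]
    have h1 : ∏ j ∈ Finset.Ico 0 (N - m), coordVar q z (s + N - j) ^ (if Even j then r else k - r) =
        ∏ j ∈ Finset.Ico 0 (N - m),
          coordVar q z (s + (N - j)) ^ (if Odd (N - j) then l else k - l) := by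
      refine Finset.prod_congr rfl fun j hj => ?_
      have hj := (Finset.mem_Ico.mp hj).2
      rw [Nat.add_sub_assoc (by omega)]
      congr 1
      rcases h with ⟨hN, rfl⟩ | ⟨hN, hlr⟩
      · have : Odd (N - j) ↔ Even j := by
          rw [Nat.odd_sub (by omega)]
          tauto
        simp only [this]
      · have : Odd (N - j) ↔ ¬ Even j := by
          rw [Nat.odd_sub (by omega), ← Nat.not_even_iff_odd]
          tauto
        simp only [this]
        split_ifs <;> omega
    rw [h1, Finset.prod_Ico_reflect (fun j => coordVar q z (s + j) ^ (if Odd j then l else k - l)) 0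
      (by omega : N - m ≤ N + 1), ← Finset.Ico_add_one_right_eq_Icc,
      ← Finset.Ico_add_one_right_eq_Icc, show N + 1 - (N - m) = m + 1 by omega]
    exact Finset.prod_Ico_consecutive _ (by omega) (by omega)
  · rw [leftDenom, rightDenom, mul_comm]

theorem alternating_sum_range_odd (f : ℕ → K) (h : ℕ) :
    ∑ m ∈ Finset.range (2 * h + 1 + 1), (-1) ^ m * f m =
      ∑ a ∈ Finset.range (h + 1), (f (2 * a) - f (2 * a + 1)) := by
  induction h with
  | zero => simp [Finset.sum_range_succ, sub_eq_add_neg]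
  | succ h ih =>
    rw [Finset.sum_range_succ _ (h + 1), ← ih, show 2 * (h + 1) + 1 + 1 = 2 * h + 1 + 1 + 1 + 1 by ring,
      Finset.sum_range_succ, Finset.sum_range_succ,
      (show Odd (2 * h + 1 + 1 + 1) by simp [parity_simps]).neg_one_pow,
      (show Even (2 * h + 1 + 1) by simp [parity_simps]).neg_one_pow,
      show 2 * (h + 1) = 2 * h + 1 + 1 by ring]
    ring

theorem alternating_sum_range_even (f : ℕ → K) (h : ℕ) :
    ∑ m ∈ Finset.range (2 * h + 1), (-1) ^ m * f m =
      ∑ a ∈ Finset.range (h + 1), f (2 * a) - ∑ a ∈ Finset.range h, f (2 * a + 1) := by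
  induction h with
  | zero => simp
  | succ h ih =>
    rw [Finset.sum_range_succ _ (h + 1), Finset.sum_range_succ (fun a => f (2 * a + 1)) h,
      add_sub_add_comm, ← ih,
      show 2 * (h + 1) + 1 = 2 * h + 1 + 1 + 1 by ring,
      Finset.sum_range_succ, Finset.sum_range_succ,
      (show Odd (2 * h + 1) by simp).neg_one_pow,
      (show Even (2 * h + 1 + 1) by simp [parity_simps]).neg_one_pow,
      show 2 * (h + 1) = 2 * h + 1 + 1 by ring]
    ring

/-- The factor of coordinate `s + 2a + 1` belongs to the right end in one case and to the left end
in the other. For odd `N` the alternating sum thus cancels in pairs. -/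
theorem denom_odd (s a b : ℕ) :
    leftDenom q z (2 * a) s * rightDenom q z (s + (2 * (a + b) + 1)) (2 * b + 1) =
      leftDenom q z (2 * a + 1) s * rightDenom q z (s + (2 * (a + b) + 1)) (2 * b) := by
  unfold leftDenom rightDenom
  rw [show (2 * a + 1) / 2 = a by omega, show 2 * a / 2 = a by omega,
    show (2 * b + 1) / 2 = b by omega, show 2 * b / 2 = b by omega,
    Finset.prod_Icc_succ_top (by omega : b + 1 ≤ 2 * b + 1),
    Finset.prod_Icc_succ_top (by omega : a + 1 ≤ 2 * a + 1),
    show s + (2 * (a + b) + 1) + 1 - (2 * b + 1) = s + (2 * a + 1) by omega]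
  ring

/-- The product of the denominators `1 - q^{-i} z^{-1}` over `n` consecutive coordinates. -/
def invProd (q z : K) (s a n : ℕ) : K :=
  ∏ i ∈ Finset.Ico (a + 1) (a + n + 1), (1 - (coordVar q z (s + i))⁻¹)

/-- The product `(1 - q) ⋯ (1 - q^a) (1 - q⁻¹) ⋯ (1 - q^{-b})`. -/
def qProd (q : K) (a b : ℕ) : K :=
  (∏ i ∈ Finset.Icc 1 a, (1 - q ^ i)) * ∏ i ∈ Finset.Icc 1 b, (1 - (q ^ i)⁻¹)

theorem prod_reflect_denom (s N b n : ℕ) (hn : n ≤ N) :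
    ∏ i ∈ Finset.Icc (b + 1) n, (1 - (coordVar q z (s + N + 1 - i))⁻¹) =
      ∏ i ∈ Finset.Ico (N + 1 - n) (N + 1 - b), (1 - (coordVar q z (s + i))⁻¹) := by
  have h := Finset.prod_Ico_reflect (fun i => 1 - (coordVar q z (s + i))⁻¹) (b + 1)
    (by omega : n + 1 ≤ N + 1 + 1)
  rw [show N + 1 + 1 - (n + 1) = N + 1 - n by omega,
    show N + 1 + 1 - (b + 1) = N + 1 - b by omega] at h
  rw [← h, Finset.Ico_add_one_right_eq_Icc]
  refine Finset.prod_congr rfl fun i hi => ?_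
  have := (Finset.mem_Icc.mp hi).2
  rw [show s + N + 1 - i = s + (N + 1 - i) by omega]

/-- The coordinate ranges of the two denominators are adjacent and merge into a single run; its
length is fixed by `N` and the parity of `m`. -/
theorem denom_even_even (s a b : ℕ) :
    leftDenom q z (2 * a) s * rightDenom q z (s + 2 * (a + b)) (2 * b) =
      qProd q a b * invProd q z s a (a + b) := by
  unfold leftDenom rightDenom qProd invProd
  rw [prod_reflect_denom _ _ _ _ (by omega), show 2 * a / 2 = a by omega,
    show 2 * b / 2 = b by omega, mul_mul_mul_comm]
  congr 1
  rw [← Finset.Ico_add_one_right_eq_Icc, show 2 * (a + b) + 1 - 2 * b = 2 * a + 1 by omega,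
    Finset.prod_Ico_consecutive _ (by omega) (by omega)]
  congr 2
  omega

theorem denom_even_odd (s a b : ℕ) :
    leftDenom q z (2 * a + 1) s * rightDenom q z (s + 2 * (a + b + 1)) (2 * b + 1) =
      qProd q a b * invProd q z s a (a + b + 1 + 1) := by
  unfold leftDenom rightDenom qProd invProd
  rw [prod_reflect_denom _ _ _ _ (by omega), show (2 * a + 1) / 2 = a by omega,
    show (2 * b + 1) / 2 = b by omega, mul_mul_mul_comm]
  congr 1
  rw [← Finset.Ico_add_one_right_eq_Icc,
    show 2 * (a + b + 1) + 1 - (2 * b + 1) = 2 * a + 1 + 1 by omega,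
    Finset.prod_Ico_consecutive _ (by omega) (by omega)]
  congr 2
  omega

theorem Generic.one_sub_q_inv_ne (h : Generic q z) {i : ℕ} (hi : 1 ≤ i) : 1 - (q ^ i)⁻¹ ≠ 0 := by
  intro h0
  apply h.q_pow i hi
  rw [sub_eq_zero] at h0 ⊢
  rw [← inv_inv (q ^ i), ← h0, inv_one]

theorem invProd_succ_right (s a n : ℕ) : invProd q z s a (n + 1) =
    invProd q z s a n * (1 - (coordVar q z (s + (a + 1) + n))⁻¹) := by
  unfold invProd
  rw [← add_assoc a n 1, Finset.prod_Ico_succ_top (by omega),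
    show s + (a + n + 1) = s + (a + 1) + n by ring]

theorem invProd_succ_left (s a n : ℕ) : invProd q z s a (n + 1) =
    (1 - (coordVar q z (s + (a + 1)))⁻¹) * invProd q z s (a + 1) n := by
  unfold invProd
  rw [Finset.prod_eq_prod_Ico_succ_bot (by omega), show a + 1 + n + 1 = a + (n + 1) + 1 by ring]

/-- The telescoping step in the wall identity for even `N`. -/
theorem inv_denom_telescope (h : Generic q z) (s a b : ℕ) :
    (1 - (q ^ (a + b + 1))⁻¹) * (qProd q a b * invProd q z s a (a + b + 1 + 1))⁻¹ =
      (1 - (q ^ (b + 1))⁻¹) * (qProd q a (b + 1) * invProd q z s a (a + b + 1))⁻¹ -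
      (q ^ (a + b + 1))⁻¹ * ((1 - q ^ (a + 1)) *
        (qProd q (a + 1) b * invProd q z s (a + 1) (a + b + 1))⁻¹) := by
  have n1 := h.one_sub_q_inv_ne (i := b + 1) (by omega)
  have n2 := h.q_pow (a + 1) (by omega)
  have u1 := h.one_sub_inv_ne (i := s + (a + 1)) (by omega)
  have u2 := h.one_sub_inv_ne (i := s + (a + 1) + (a + b + 1)) (by omega)
  have e1 : (1 - (q ^ (b + 1))⁻¹) * (qProd q a (b + 1) * invProd q z s a (a + b + 1))⁻¹ =
      (1 - (coordVar q z (s + (a + 1) + (a + b + 1)))⁻¹) *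
        (qProd q a b * invProd q z s a (a + b + 1 + 1))⁻¹ := by
    rw [invProd_succ_right s a (a + b + 1)]
    unfold qProd
    rw [Finset.prod_Icc_succ_top (by omega : 1 ≤ b + 1)]
    simp only [mul_inv]
    linear_combination ((∏ i ∈ Finset.Icc 1 a, (1 - q ^ i))⁻¹ *
      (∏ i ∈ Finset.Icc 1 b, (1 - (q ^ i)⁻¹))⁻¹ * (invProd q z s a (a + b + 1))⁻¹) *
      (mul_inv_cancel₀ n1 - mul_inv_cancel₀ u2)
  have e2 : (1 - q ^ (a + 1)) * (qProd q (a + 1) b * invProd q z s (a + 1) (a + b + 1))⁻¹ =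
      (1 - (coordVar q z (s + (a + 1)))⁻¹) *
        (qProd q a b * invProd q z s a (a + b + 1 + 1))⁻¹ := by
    rw [invProd_succ_left s a (a + b + 1)]
    unfold qProd
    rw [Finset.prod_Icc_succ_top (by omega : 1 ≤ a + 1)]
    simp only [mul_inv]
    linear_combination ((∏ i ∈ Finset.Icc 1 a, (1 - q ^ i))⁻¹ *
      (∏ i ∈ Finset.Icc 1 b, (1 - (q ^ i)⁻¹))⁻¹ * (invProd q z s (a + 1) (a + b + 1))⁻¹) *
      (mul_inv_cancel₀ n2 - mul_inv_cancel₀ u1)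
  -- With `Q = q ^ (a + b + 1)` and `Y` the coordinate variable at `s + (a + 1)`, the claim is now
  -- `1 - Q⁻¹ = (1 - (Q * Y)⁻¹) - Q⁻¹ * (1 - Y⁻¹)` times a common factor.
  rw [e1, e2, coordVar_add q z (s + (a + 1)), mul_inv]
  ring

/-- After multiplication by `1 - q^{-n}`, each right-hand term splits between the left-hand terms
`a` and `a + 1`. The total coefficient of term `a` is `(1 - q^{a-n}) - q^{-n} (1 - q^a) = 1 -
q^{-n}`. -/
theorem sum_inv_denom_even (h : Generic q z) (s n : ℕ) (hn : 1 ≤ n) :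
    ∑ a ∈ Finset.range (n + 1), (qProd q a (n - a) * invProd q z s a n)⁻¹ =
      ∑ a ∈ Finset.range n, (qProd q a (n - 1 - a) * invProd q z s a (n + 1))⁻¹ := by
  have hQ := h.one_sub_q_inv_ne hn
  have hq := h.q_ne
  apply mul_left_cancel₀ hQ
  set E : ℕ → K := fun a => (qProd q a (n - a) * invProd q z s a n)⁻¹
  have key : ∀ a ∈ Finset.range n,
      (1 - (q ^ n)⁻¹) * (qProd q a (n - 1 - a) * invProd q z s a (n + 1))⁻¹ =
        (1 - (q ^ (n - a))⁻¹) * E a - (q ^ n)⁻¹ * ((1 - q ^ (a + 1)) * E (a + 1)) := by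
    intro a ha
    obtain ⟨b, rfl⟩ : ∃ b, n = a + b + 1 := ⟨n - 1 - a, by
      have := Finset.mem_range.mp ha
      omega⟩
    simp only [E]
    rw [show a + b + 1 - 1 - a = b by omega, show a + b + 1 - a = b + 1 by omega,
      show a + b + 1 - (a + 1) = b by omega]
    exact inv_denom_telescope h s a b
  rw [Finset.mul_sum (Finset.range n), Finset.sum_congr rfl key, Finset.sum_sub_distrib,
    ← Finset.mul_sum (Finset.range n)]
  -- Both sums extend to the full range because the first coefficient vanishes at `a = n` and the
  -- second at `a = 0`.
  have h1 : ∑ a ∈ Finset.range n, (1 - (q ^ (n - a))⁻¹) * E a =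
      ∑ a ∈ Finset.range (n + 1), (1 - (q ^ (n - a))⁻¹) * E a := by
    rw [Finset.sum_range_succ]
    simp
  have h2 : ∑ a ∈ Finset.range n, (1 - q ^ (a + 1)) * E (a + 1) =
      ∑ a ∈ Finset.range (n + 1), (1 - q ^ a) * E a := by
    rw [Finset.sum_range_succ']
    simp
  rw [h1, h2, Finset.mul_sum, Finset.mul_sum, ← Finset.sum_sub_distrib]
  refine Finset.sum_congr rfl fun a ha => ?_
  have ha := Finset.mem_range_succ_iff.mp ha
  have : (q ^ (n - a))⁻¹ = q ^ a * (q ^ n)⁻¹ := by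
    obtain ⟨b, rfl⟩ := Nat.exists_eq_add_of_le ha
    rw [Nat.add_sub_cancel_left, pow_add]
    field_simp
  rw [this]
  ring

theorem wallIdentity (h : Generic q z) : WallIdentity q z k r := by
  intro N s l hl hN hc
  rw [← sub_eq_zero, vertexSum_zero_sub_one]
  rw [Finset.sum_congr rfl fun m hm => by
    rw [right_mul_left_wall hl hc (Finset.mem_range_succ_iff.mp hm), ← mul_assoc,
      mul_comm ((-1 : K) ^ m), mul_assoc], ← Finset.mul_sum]
  refine mul_eq_zero_of_right _ ?_
  rcases Nat.even_or_odd' N with ⟨n, rfl | rfl⟩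
  · rw [alternating_sum_range_even (fun m => (leftDenom q z m s *
      rightDenom q z (s + 2 * n) (2 * n - m))⁻¹), sub_eq_zero]
    refine Eq.trans ?_ ((sum_inv_denom_even h s n (by omega)).trans ?_)
    · refine Finset.sum_congr rfl fun a ha => ?_
      obtain ⟨b, rfl⟩ := Nat.exists_eq_add_of_le (Finset.mem_range_succ_iff.mp ha)
      rw [show 2 * (a + b) - 2 * a = 2 * b by omega, Nat.add_sub_cancel_left, denom_even_even]
    · refine Finset.sum_congr rfl fun a ha => ?_
      obtain ⟨b, rfl⟩ := Nat.exists_eq_add_of_le (Nat.succ_le_of_lt (Finset.mem_range.mp ha))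
      rw [show a.succ + b = a + b + 1 by omega, show a + b + 1 - 1 - a = b by omega,
        show 2 * (a + b + 1) - (2 * a + 1) = 2 * b + 1 by omega, denom_even_odd]
  · rw [alternating_sum_range_odd (fun m => (leftDenom q z m s *
      rightDenom q z (s + (2 * n + 1)) (2 * n + 1 - m))⁻¹)]
    refine Finset.sum_eq_zero fun a ha => ?_
    obtain ⟨b, rfl⟩ := Nat.exists_eq_add_of_le (Finset.mem_range_succ_iff.mp ha)
    rw [show 2 * (a + b) + 1 - 2 * a = 2 * b + 1 by omega,
      show 2 * (a + b) + 1 - (2 * a + 1) = 2 * b by omega, denom_odd, sub_self]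

end Field

/-! ### Geometric series in `ℤ[[q,z]]` -/

theorem qz_eq_monomial (a b : ℕ) :
    qz a b = MvPowerSeries.monomial (Finsupp.single 0 a + Finsupp.single 1 b) 1 := by
  rw [qz, MvPowerSeries.X_pow_eq, MvPowerSeries.X_pow_eq, MvPowerSeries.monomial_mul_monomial,
    one_mul]

open Classical in
theorem coeff_geomExpansion (a b : ℕ) (d : Fin 2 →₀ ℕ) :
    MvPowerSeries.coeff d (geomExpansion a b) =
      if ∃ i : ℤ, 0 ≤ i ∧ (d 0 : ℤ) = i * a ∧ (d 1 : ℤ) = i * b then 1 else 0 := by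
  rfl

theorem one_sub_qz_mul_geomExpansion {a b : ℕ} (hab : 1 ≤ a ∨ 1 ≤ b) :
    (1 - qz a b) * geomExpansion a b = 1 := by
  classical
  ext d
  set x : Fin 2 →₀ ℕ := Finsupp.single 0 a + Finsupp.single 1 b
  have hx0 : x 0 = a := by simp [x]
  have hx1 : x 1 = b := by simp [x]
  have hle : x ≤ d ↔ a ≤ d 0 ∧ b ≤ d 1 := by
    rw [Finsupp.le_def, Fin.forall_fin_two, hx0, hx1]
  have hd : d = 0 ↔ d 0 = 0 ∧ d 1 = 0 := by
    rw [Finsupp.ext_iff, Fin.forall_fin_two]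
    rfl
  rw [sub_mul, one_mul, map_sub, qz_eq_monomial, MvPowerSeries.coeff_monomial_mul, one_mul,
    MvPowerSeries.coeff_one, coeff_geomExpansion, coeff_geomExpansion, Finsupp.tsub_apply, Finsupp.tsub_apply]
  change _ - ite (x ≤ d) (ite (∃ i : ℤ, 0 ≤ i ∧ ((d 0 - x 0 : ℕ) : ℤ) = i * a ∧
    ((d 1 - x 1 : ℕ) : ℤ) = i * b) 1 0) 0 = _
  rw [hx0, hx1]
  by_cases h0 : d = 0
  · have h0' := hd.mp h0
    rw [if_pos h0, if_neg (show ¬ x ≤ d by rw [hle]; omega), if_pos, sub_zero]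
    exact ⟨0, le_rfl, by simp [h0'.1], by simp [h0'.2]⟩
  · rw [if_neg h0]
    have h0' := mt hd.mpr h0
    by_cases hxd : x ≤ d
    · have hxd' := hle.mp hxd
      rw [if_pos hxd, sub_eq_zero]
      refine if_congr ⟨?_, ?_⟩ rfl rfl
      · rintro ⟨i, hi, h1, h2⟩
        have : i ≠ 0 := by
          rintro rfl
          exact h0' ⟨by simpa using h1, by simpa using h2⟩
        refine ⟨i - 1, by omega, ?_, ?_⟩
        · push_cast [hxd'.1]
          linarith
        · push_cast [hxd'.2]
          linarith
      · rintro ⟨i, hi, h1, h2⟩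
        push_cast [hxd'.1, hxd'.2] at h1 h2
        exact ⟨i + 1, by omega, by linarith, by linarith⟩
    · rw [if_neg hxd, if_neg, sub_zero]
      rintro ⟨i, hi, h1, h2⟩
      rcases hi.eq_or_lt with rfl | hi
      · exact h0' ⟨by simpa using h1, by simpa using h2⟩
      · rw [hle] at hxd
        have e1 : (a : ℤ) ≤ d 0 := by rw [h1]; nlinarith [Int.natCast_nonneg a]
        have e2 : (b : ℤ) ≤ d 1 := by rw [h2]; nlinarith [Int.natCast_nonneg b]
        omega

/-- The negative expansion is `-∑_{i>0} x^i`, which represents `1 / (1 - x⁻¹)`. Both expansion rules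
are thus compatible with rational functions, and the theorem can be checked in the fraction field.
-/
theorem geomExpansion_neg {a b : ℕ} (hab : 1 ≤ a ∨ 1 ≤ b) :
    geomExpansion (-a) (-b) = 1 - geomExpansion a b := by
  classical
  ext d
  have h2 : MvPowerSeries.coeff d (geomExpansion (-a) (-b)) =
      if ∃ i : ℤ, i < 0 ∧ (d 0 : ℤ) = i * (-a) ∧ (d 1 : ℤ) = i * (-b) then -1 else 0 := by
    change (if _ then _ else _) = _
    rw [if_neg (by omega), if_pos (by omega)]
  have hd : d = 0 ↔ d 0 = 0 ∧ d 1 = 0 := by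
    rw [Finsupp.ext_iff, Fin.forall_fin_two]
    rfl
  rw [map_sub, coeff_geomExpansion, h2, MvPowerSeries.coeff_one]
  by_cases h0 : d = 0
  · have h0' := hd.mp h0
    rw [if_pos h0, if_neg, if_pos, sub_self]
    · exact ⟨0, le_rfl, by simp [h0'.1], by simp [h0'.2]⟩
    · clear h2
      rintro ⟨i, hi, e1, e2⟩
      rw [h0'.1, Nat.cast_zero, eq_comm, mul_eq_zero] at e1
      rw [h0'.2, Nat.cast_zero, eq_comm, mul_eq_zero] at e2
      omega
  · have h0' := mt hd.mpr h0
    have hiff : (∃ i : ℤ, i < 0 ∧ (d 0 : ℤ) = i * (-a) ∧ (d 1 : ℤ) = i * (-b)) ↔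
        ∃ i : ℤ, 0 ≤ i ∧ (d 0 : ℤ) = i * a ∧ (d 1 : ℤ) = i * b := by
      constructor
      · rintro ⟨i, hi, e1, e2⟩
        exact ⟨-i, by omega, by linarith, by linarith⟩
      · rintro ⟨i, hi, e1, e2⟩
        refine ⟨-i, ?_, by linarith, by linarith⟩
        have : i ≠ 0 := by
          rintro rfl
          exact h0' ⟨by simpa using e1, by simpa using e2⟩
        omega
    rw [if_neg h0]
    by_cases h : ∃ i : ℤ, 0 ≤ i ∧ (d 0 : ℤ) = i * a ∧ (d 1 : ℤ) = i * b
    · rw [if_pos h, if_pos (hiff.mpr h)]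
      simp
    · rw [if_neg h, if_neg (mt hiff.mp h)]
      simp

/-! ### Passage to the field of fractions -/

/-- The field of fractions of `ℤ[[q,z]]`. -/
abbrev SeriesField : Type := FractionRing Series

/-- The embedding of `ℤ[[q,z]]` into its field of fractions. -/
noncomputable def toField : Series →+* SeriesField := algebraMap Series SeriesField

theorem toField_injective : Function.Injective toField :=
  IsFractionRing.injective Series SeriesField

/-- The element `q` of the field of fractions. -/
noncomputable def qF : SeriesField := toField (MvPowerSeries.X 0)

/-- The element `z` of the field of fractions. -/
noncomputable def zF : SeriesField := toField (MvPowerSeries.X 1)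

theorem toField_qz (a b : ℕ) : toField (qz a b) = qF ^ a * zF ^ b := by
  rw [qz, map_mul, map_pow, map_pow]
  rfl

theorem toField_X_ne_zero (i : Fin 2) : toField (MvPowerSeries.X i) ≠ 0 := by
  rw [Ne, map_eq_zero_iff _ toField_injective]
  intro h
  have := congrArg (MvPowerSeries.coeff (Finsupp.single i 1)) h
  simp at this

theorem one_sub_toField_qz_mul {a b : ℕ} (hab : 1 ≤ a ∨ 1 ≤ b) :
    (1 - qF ^ a * zF ^ b) * toField (geomExpansion a b) = 1 := by
  rw [← toField_qz, ← map_one toField, ← map_sub, ← map_mul, one_sub_qz_mul_geomExpansion hab]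

theorem one_sub_toField_qz_ne_zero {a b : ℕ} (hab : 1 ≤ a ∨ 1 ≤ b) :
    1 - qF ^ a * zF ^ b ≠ 0 :=
  left_ne_zero_of_mul_eq_one (one_sub_toField_qz_mul hab)

theorem generic_qF_zF : Generic qF zF where
  q_ne := toField_X_ne_zero 0
  z_ne := toField_X_ne_zero 1
  q_pow i hi := by simpa using one_sub_toField_qz_ne_zero (a := i) (b := 0) (Or.inl hi)
  q_pow_z i hi := by simpa using one_sub_toField_qz_ne_zero (a := i) (b := 1) (Or.inl hi)

theorem toField_geomExpansion {a b : ℕ} (hab : 1 ≤ a ∨ 1 ≤ b) :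
    toField (geomExpansion a b) = (1 - qF ^ a * zF ^ b)⁻¹ :=
  eq_inv_of_mul_eq_one_right (one_sub_toField_qz_mul hab)

theorem toField_geomExpansion_neg {a b : ℕ} (hab : 1 ≤ a ∨ 1 ≤ b) :
    toField (geomExpansion (-a) (-b)) = (1 - (qF ^ a * zF ^ b)⁻¹)⁻¹ := by
  rw [geomExpansion_neg hab, map_sub, map_one, toField_geomExpansion hab]
  have h1 := one_sub_toField_qz_ne_zero hab
  have h2 : qF ^ a * zF ^ b ≠ 0 :=
    mul_ne_zero (pow_ne_zero _ generic_qF_zF.q_ne) (pow_ne_zero _ generic_qF_zF.z_ne)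
  generalize qF ^ a * zF ^ b = y at *
  have h3 : 1 - y⁻¹ ≠ 0 := by
    intro h0
    apply h1
    rw [sub_eq_zero] at h0 ⊢
    rw [← inv_inv y, ← h0, inv_one]
  refine eq_inv_of_mul_eq_one_left ?_
  field_simp
  ring

theorem toField_contribution {N m n k l r : ℕ} (hl : l ≤ k) (h : m + n ≤ N) :
    toField (contribution N m n k l r) =
      rightEnd qF zF k N n r * (leftEnd qF zF k m 0 l * middle qF zF m (N - n)) := by
  rw [leftEnd_eq m 0 l hl, rightEnd, leftDenom, middle, contribution]
  simp only [map_mul, map_prod, zero_add]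
  have e1 : ∏ i ∈ Finset.Icc 1 (m / 2), toField (geomExpansion i 0) =
      (∏ i ∈ Finset.Icc 1 (m / 2), (1 - qF ^ i))⁻¹ := by
    rw [← Finset.prod_inv_distrib]
    refine Finset.prod_congr rfl fun i hi => ?_
    simpa using toField_geomExpansion (a := i) (b := 0) (Or.inl (Finset.mem_Icc.mp hi).1)
  have e2 : ∏ i ∈ Finset.Icc (m / 2 + 1) m, toField (geomExpansion (-i) (-1)) =
      (∏ i ∈ Finset.Icc (m / 2 + 1) m, (1 - (coordVar qF zF i)⁻¹))⁻¹ := by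
    rw [← Finset.prod_inv_distrib]
    refine Finset.prod_congr rfl fun i hi => ?_
    simpa [coordVar] using toField_geomExpansion_neg (a := i) (b := 1) (Or.inr le_rfl)
  have e3 : ∏ i ∈ Finset.Icc (m + 1) (N - n), toField (geomExpansion i 1) =
      ∏ i ∈ Finset.Ioc m (N - n), (1 - coordVar qF zF i)⁻¹ := by
    rw [← Finset.Icc_add_one_left_eq_Ioc]
    refine Finset.prod_congr rfl fun i hi => ?_
    simpa [coordVar] using toField_geomExpansion (a := i) (b := 1) (Or.inr le_rfl)
  have e4 : ∏ i ∈ Finset.Icc 1 (n / 2), toField (geomExpansion (-i) 0) =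
      (∏ i ∈ Finset.Icc 1 (n / 2), (1 - (qF ^ i)⁻¹))⁻¹ := by
    rw [← Finset.prod_inv_distrib]
    refine Finset.prod_congr rfl fun i hi => ?_
    simpa using toField_geomExpansion_neg (a := i) (b := 0) (Or.inl (Finset.mem_Icc.mp hi).1)
  have e5 : ∏ i ∈ Finset.Icc (n / 2 + 1) n, toField (geomExpansion ((i : ℤ) - N - 1) (-1)) =
      (∏ i ∈ Finset.Icc (n / 2 + 1) n, (1 - (coordVar qF zF (N + 1 - i))⁻¹))⁻¹ := by
    rw [← Finset.prod_inv_distrib]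
    refine Finset.prod_congr rfl fun i hi => ?_
    have := (Finset.mem_Icc.mp hi).2
    have h2 := toField_geomExpansion_neg (a := N + 1 - i) (b := 1) (Or.inr le_rfl)
    rw [show (-((N + 1 - i : ℕ) : ℤ)) = (i : ℤ) - N - 1 by omega] at h2
    simpa [coordVar] using h2
  have e6 : toField (qz (phiQ N m n k l r) (phiZ N m n k l r)) =
      ∏ j ∈ Finset.Ico 1 (N + 1), coordVar qF zF j ^ vertexCoord N m n k l r j := by
    simp only [toField_qz, phiQ, phiZ, coordVar, mul_pow, Finset.prod_mul_distrib, ← pow_mul,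
      Finset.prod_pow_eq_pow_sum, Finset.Ico_add_one_right_eq_Icc]
  have e7 : ∏ j ∈ Finset.Ico 1 (m + 1), coordVar qF zF j ^ vertexCoord N m n k l r j =
      ∏ j ∈ Finset.Icc 1 m, coordVar qF zF j ^ (if Odd j then l else k - l) := by
    rw [Finset.Ico_add_one_right_eq_Icc]
    refine Finset.prod_congr rfl fun j hj => ?_
    rw [vertexCoord, if_pos (Finset.mem_Icc.mp hj).2]
  have e8 : ∏ j ∈ Finset.Ico (m + 1) (N - n + 1),
      coordVar qF zF j ^ vertexCoord N m n k l r j = 1 := by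
    refine Finset.prod_eq_one fun j hj => ?_
    have := Finset.mem_Ico.mp hj
    rw [vertexCoord, if_neg (by omega), if_neg (by omega), pow_zero]
  have e9 : ∏ j ∈ Finset.Ico (N - n + 1) (N + 1), coordVar qF zF j ^ vertexCoord N m n k l r j =
      ∏ j ∈ Finset.range n, coordVar qF zF (N - j) ^ (if Even j then r else k - r) := by
    have h2 := Finset.prod_Ico_reflect (fun j => coordVar qF zF j ^ vertexCoord N m n k l r j) 0
      (by omega : n ≤ N + 1)
    rw [Nat.sub_zero, show N + 1 - n = N - n + 1 by omega] at h2
    rw [← h2, ← Finset.range_eq_Ico]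
    refine Finset.prod_congr rfl fun j hj => ?_
    have := Finset.mem_range.mp hj
    rw [vertexCoord, if_neg (by omega), if_pos (by omega), show N - (N - j) = j by omega]
  rw [e1, e2, e3, e4, e5, e6,
    ← Finset.prod_Ico_consecutive _ (by omega : 1 ≤ m + 1) (by omega : m + 1 ≤ N + 1),
    ← Finset.prod_Ico_consecutive _ (by omega : m + 1 ≤ N - n + 1) (by omega : N - n + 1 ≤ N + 1),
    e7, e8, e9]
  simp only [div_eq_mul_inv, mul_inv]
  ring

theorem toField_sum_contribution {N k l r p : ℕ} (hl : l ≤ k) (P : ℕ → Prop) [DecidablePred P]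
    (hP : ∀ m, P m ↔ m % 2 = p % 2) :
    toField (∑ x ∈ Finset.range (N + 1) ×ˢ Finset.range (N + 1) with
      x.1 + x.2 < N ∨ (x.1 + x.2 = N ∧ P x.1), contribution N x.1 x.2 k l r) =
      vertexSum qF zF k r p 0 N l := by
  rw [map_sum, Finset.sum_filter, Finset.sum_product_right, vertexSum]
  refine Finset.sum_congr rfl fun n hn => ?_
  have hn := Finset.mem_range_succ_iff.mp hn
  simp only
  -- For fixed `n` only `m ≤ N - n` contributes; the top value `m = N - n` leaves no zero
  -- coordinates and carries the parity condition.
  rw [← Finset.sum_subset (Finset.range_subset_range.mpr (by omega : N - n + 1 ≤ N + 1)),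
    Finset.sum_range_succ, leftSum, mul_add, Finset.mul_sum]
  · congr 1
    · refine Finset.sum_congr rfl fun m hm => ?_
      have := Finset.mem_range.mp hm
      rw [if_pos (by omega), toField_contribution hl (by omega), zero_add, zero_add, zero_add]
    · by_cases hp : P (N - n)
      · rw [if_pos (Or.inr ⟨by omega, hp⟩), if_pos ((hP _).mp hp),
          toField_contribution hl (by omega), middle, Finset.Ioc_self, Finset.prod_empty, mul_one,
          zero_add]
      · rw [if_neg (by simp only [hp, and_false, or_false]; omega), if_neg (mt (hP _).mpr hp),
          mul_zero]
  · intro m _ hm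
    have := mt Finset.mem_range.mpr hm
    rw [if_neg (by omega)]

theorem toField_sumE {N k l r : ℕ} (hl : l ≤ k) :
    toField (sumE N k l r) = vertexSum qF zF k r 0 0 N l := by
  rw [← toField_sum_contribution hl Even fun m => by rw [Nat.even_iff]]
  rfl

theorem toField_sumO {N k l r : ℕ} (hl : l ≤ k) :
    toField (sumO N k l r) = vertexSum qF zF k r 1 0 N l := by
  rw [← toField_sum_contribution hl Odd fun m => by rw [Nat.odd_iff]]
  rfl

/-! ### The generating function of the admissible exponents -/

/-- The admissible exponents, where a bound on the first one is propagated through the others. -/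
def latticeSet (k r : ℕ) : (N : ℕ) → ℕ → Finset (Fin N → ℕ)
  | 0, l => if k ≤ l + r then Finset.univ else ∅
  | N + 1, l => ((Finset.range (l + 1)).sigma fun j => latticeSet k r N (k - j)).map
      ⟨fun x => (Fin.cons x.1 x.2 : Fin (N + 1) → ℕ), fun x y h => by
        obtain ⟨a, b⟩ := x
        obtain ⟨c, d⟩ := y
        obtain ⟨rfl, rfl⟩ := Fin.cons_injective2 h
        rfl⟩

theorem mem_latticeSet_succ {k r N l : ℕ} {b : Fin (N + 1) → ℕ} :
    b ∈ latticeSet k r (N + 1) l ↔ b 0 ≤ l ∧ Fin.tail b ∈ latticeSet k r N (k - b 0) := by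
  simp only [latticeSet, Finset.mem_map, Finset.mem_sigma, Finset.mem_range, Nat.lt_succ_iff]
  constructor
  · rintro ⟨x, ⟨h1, h2⟩, rfl⟩
    exact ⟨h1, h2⟩
  · rintro ⟨h1, h2⟩
    exact ⟨⟨b 0, Fin.tail b⟩, ⟨h1, h2⟩, Fin.cons_self_tail b⟩

theorem latticeSum_eq_sum {K : Type*} [Field K] (q z : K) (k r N : ℕ) : ∀ s l : ℕ,
    latticeSum q z k r N s l =
      ∑ b ∈ latticeSet k r N l, ∏ i : Fin N, coordVar q z (s + i + 1) ^ b i := by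
  induction N with
  | zero =>
    intro s l
    rw [latticeSum, latticeSet]
    split_ifs <;> simp
  | succ N ih =>
    intro s l
    rw [latticeSum, latticeSet, Finset.sum_map, Finset.sum_sigma]
    refine Finset.sum_congr rfl fun j _ => ?_
    rw [ih, Finset.mul_sum]
    refine Finset.sum_congr rfl fun b _ => ?_
    simp only [Fin.prod_univ_succ, Fin.val_zero, Fin.val_succ, add_zero]
    congr 1
    refine Finset.prod_congr rfl fun i _ => ?_
    rw [show s + 1 + (i : ℕ) + 1 = s + (i + 1) + 1 by ring]
    rfl

/-- Passing the bound `k - b_i` to the next coordinate encodes `b_i + b_{i+1} ≤ k`, and the terminal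
test encodes `b_N ≤ r`. At least one coordinate is needed, since with none the terminal test has no
counterpart in `IsAdmissible`. -/
theorem mem_latticeSet_iff {k r : ℕ} (N : ℕ) : ∀ {l : ℕ}, l ≤ k →
    ∀ b : Fin (N + 1) →₀ ℕ, ⇑b ∈ latticeSet k r (N + 1) l ↔ IsAdmissible (N + 1) k l r b := by
  induction N with
  | zero =>
    intro l hl b
    rw [mem_latticeSet_succ, latticeSet]
    have hadm : IsAdmissible (0 + 1) k l r b ↔ b 0 ≤ l ∧ b 0 ≤ r := by
      constructor
      · exact fun h => ⟨h.1 0 rfl, h.2.1 0 rfl⟩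
      · refine fun h => ⟨fun i _ => ?_, fun i _ => ?_, fun i j hij => ?_⟩
        · rw [show i = 0 from Fin.ext (by omega)]
          exact h.1
        · rw [show i = 0 from Fin.ext (by omega)]
          exact h.2
        · have := j.isLt
          omega
    rw [hadm]
    split_ifs with h
    · simp only [Finset.mem_univ, and_true]
      omega
    · simp only [Finset.notMem_empty, and_false, false_iff]
      omega
  | succ N ih =>
    intro l hl b
    obtain ⟨c, hc⟩ : ∃ c : Fin (N + 1) →₀ ℕ, ⇑c = Fin.tail ⇑b :=
      ⟨Finsupp.equivFunOnFinite.symm (Fin.tail ⇑b), rfl⟩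
    have hcb (i : Fin (N + 1)) : c i = b i.succ := congrFun hc i
    rw [mem_latticeSet_succ, ← hc, ih (Nat.sub_le k (b 0))]
    constructor
    · rintro ⟨h0, h1, h2, h3⟩
      refine ⟨fun i hi => ?_, fun i hi => ?_, fun i j hij => ?_⟩
      · rwa [show i = 0 from Fin.ext hi]
      · obtain ⟨i, rfl⟩ := Fin.exists_succ_eq.mpr (show i ≠ 0 by rintro rfl; simp at hi)
        rw [← hcb]
        exact h2 i (by simpa using hi)
      · obtain ⟨j, rfl⟩ := Fin.exists_succ_eq.mpr (show j ≠ 0 by rintro rfl; simp at hij)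
        rw [← hcb]
        rcases Fin.eq_zero_or_eq_succ i with rfl | ⟨i, rfl⟩
        · have := h1 j (by simpa using hij)
          omega
        · rw [← hcb]
          exact h3 i j (by simpa using hij)
    · rintro ⟨h1, h2, h3⟩
      refine ⟨h1 0 rfl, fun i hi => ?_, fun i hi => ?_, fun i j hij => ?_⟩
      · have := h3 0 i.succ (by simp [hi])
        rw [hcb]
        omega
      · rw [hcb]
        exact h2 i.succ (by simpa using hi)
      · rw [hcb, hcb]
        exact h3 i.succ j.succ (by simpa using hij)

theorem hilbertD_eq_sum {N k l r : ℕ} (hN : 2 ≤ N) (hl : l ≤ k) :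
    hilbertD N k l r =
      ∑ b ∈ latticeSet k r N l, qz (∑ i, b i * ((i : ℕ) + 1)) (∑ i, b i) := by
  classical
  ext d
  have h1 : MvPowerSeries.coeff d (hilbertD N k l r) =
      (Nat.card (admissibleSet N k l r (d 0) (d 1)) : ℤ) := by
    rw [← finrank_component hN]
    rfl
  have hqz (a b : ℕ) : MvPowerSeries.coeff d (qz a b) = if a = d 0 ∧ b = d 1 then 1 else 0 := by
    rw [qz_eq_monomial, MvPowerSeries.coeff_monomial]
    refine if_congr ?_ rfl rfl
    rw [Finsupp.ext_iff, Fin.forall_fin_two]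
    simp [eq_comm]
  rw [h1, map_sum]
  simp only [hqz]
  rw [Finset.sum_boole, Nat.cast_inj]
  obtain ⟨M, rfl⟩ : ∃ M, N = M + 1 := ⟨N - 1, by omega⟩
  refine (Nat.card_congr ?_).trans (Nat.card_eq_fintype_card.trans (Fintype.card_coe _))
  refine Finsupp.equivFunOnFinite.subtypeEquiv fun b => ?_
  rw [Finset.mem_filter, admissibleSet, Set.mem_ofPred_eq, qWeight_eq_sum, Finsupp.degree_eq_sum]
  exact and_congr_left' (mem_latticeSet_iff M hl b).symm

theorem toField_hilbertD {N k l r : ℕ} (hN : 2 ≤ N) (hl : l ≤ k) :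
    toField (hilbertD N k l r) = latticeSum qF zF k r N 0 l := by
  rw [hilbertD_eq_sum hN hl, latticeSum_eq_sum, map_sum]
  refine Finset.sum_congr rfl fun b _ => ?_
  simp only [toField_qz, coordVar, mul_pow, Finset.prod_mul_distrib, ← pow_mul,
    Finset.prod_pow_eq_pow_sum, zero_add, mul_comm]

end Bosonic

/-! ### Comparison in the fraction field -/

theorem theorem3 (N k l r : ℕ) (hN : 2 ≤ N) (hl : l ≤ k) (hr : r ≤ k) :
    (Odd N → l ≤ r → Bosonic.hilbertD N k l r = Bosonic.sumO N k l r) ∧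
    (Odd N → r ≤ l → Bosonic.hilbertD N k l r = Bosonic.sumE N k l r) ∧
    (Even N → l + r ≤ k → Bosonic.hilbertD N k l r = Bosonic.sumO N k l r) ∧
    (Even N → k ≤ l + r → Bosonic.hilbertD N k l r = Bosonic.sumE N k l r) := by
  open Bosonic in
  have h := latticeSum_eq generic_qF_zF hr (wallIdentity generic_qF_zF) N 0 l hl
  have hO : ((Odd N ∧ l ≤ r) ∨ (Even N ∧ l + r < k) ∨ (Even N ∧ 1 ≤ N ∧ l + r ≤ k)) →
      hilbertD N k l r = sumO N k l r := fun hc => toField_injective (by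
    rw [toField_hilbertD hN hl, toField_sumO hl, h.2 hc])
  have hE : ((Odd N ∧ r ≤ l) ∨ (Even N ∧ k ≤ l + r)) →
      hilbertD N k l r = sumE N k l r := fun hc => toField_injective (by
    rw [toField_hilbertD hN hl, toField_sumE hl, h.1 hc])
  exact ⟨fun h1 h2 => hO (Or.inl ⟨h1, h2⟩), fun h1 h2 => hE (Or.inl ⟨h1, h2⟩),
    fun h1 h2 => hO (Or.inr (Or.inr ⟨h1, by omega, h2⟩)), fun h1 h2 => hE (Or.inr ⟨h1, h2⟩)⟩
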